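/- There is a constant $c>0$ such that for every integer $k\ge 1$ there is a strong quantum coin-flipping protocol for $k$ parties with bias at most $\frac12-\frac ck$, even when up to $k-1$ of the parties are dishonest. Here a $k$-party quantum protocol with $N$ rounds consists of finite-dimensional private spaces $\mathcal A_1,\dots,\mathcal A_k$ and a finite-dimensional message space $\mathcal M$, all initialised in fixed basis states; indices $i_1,\dots,i_N\in\{1,\dots,k\}$ saying whose turn it is in each round; unitaries $U_j$ on $\mathcal A_{i_j}\otimes\mathcal M$ for $1\le j\le N$, applied one after the other; and, for each party $i$, projections $\Pi_{i,0},\Pi_{i,1}$ of $\mathcal A_i$ onto two orthogonal subspaces, by which party $i$ finally measures its outcome $0$ or $1$ (obtaining neither means that party $i$ aborts). It is a strong coin-flipping protocol with bias at most $\epsilon$ if 1. when all parties are honest, the final state $|\psi_N\rangle$ satisfies $\tilde\Pi_{i,b}|\psi_N\rangle=\tilde\Pi_{i',b}|\psi_N\rangle$ and $\|\tilde\Pi_{i,b}|\psi_N\rangle\|^2=\frac12$ for all parties $i,i'$ and $b\in\{0,1\}$, where $\tilde\Pi_{i,b}$ is $\Pi_{i,b}$ tensored with the identity on all other spaces (all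 parties obtain the same bit, which is uniformly distributed); 2. for every set $D$ of dishonest parties with at least one party outside $D$, and every joint strategy of $D$, every honest party $i\notin D$ obtains outcome $b$ with probability at most $\frac12+\epsilon$, for each $b\in\{0,1\}$. A joint strategy of $D$ may share an auxiliary system of arbitrary finite dimension and apply arbitrary unitaries to the private spaces of the parties in $D$, the message space and the auxiliary system before every round (including the turns of the parties in $D$), but it cannot access the private spaces of the honest parties, who apply their prescribed $U_j$. -/

import Mathlib

namespace QuantumCoin

/-- An `N`-round quantum protocol for `k` parties that communicate through a message space.
Party `i` has a private register with finite basis `A i`, the message register has finite basis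
`M`, and the initial joint state is the basis state given by `initA` and `initM`.  In round `t`
party `turn t` applies the unitary `U t` to its private register and the message register.  At the
end party `i` measures its private register with the two orthogonal projections `proj i false`
(outcome `0`) and `proj i true` (outcome `1`); if neither outcome is obtained, party `i` aborts.
A party's private random choices are part of the purified unitaries. -/
structure Protocol (k : ℕ) where
  A : Fin k → Type
  M : Type
  [fintypeA : ∀ i, Fintype (A i)]
  [decEqA : ∀ i, DecidableEq (A i)]
  [fintypeM : Fintype M]
  [decEqM : DecidableEq M]
  initA : ∀ i, A i
  initM : M
  N : ℕ
  turn : Fin N → Fin k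
  U : (t : Fin N) → Matrix (A (turn t) × M) (A (turn t) × M) ℂ
  U_unitary : ∀ t, U t ∈ Matrix.unitaryGroup (A (turn t) × M) ℂ
  proj : (i : Fin k) → Bool → Matrix (A i) (A i) ℂ
  proj_isStarProjection : ∀ i b, IsStarProjection (proj i b)
  proj_orthogonal : ∀ i, proj i false * proj i true = 0

namespace Protocol

attribute [instance] Protocol.fintypeA Protocol.decEqA Protocol.fintypeM Protocol.decEqM

variable {k : ℕ} (P : Protocol k)

/-- The basis of the joint space of all private registers, the message register, and an additional
register with basis `Z`. -/
abbrev Basis (Z : Type) : Type := ((i : Fin k) → P.A i) × P.M × Z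

/-- The extension of an operator on the private register of party `i` and the message register to
the joint space, acting as the identity on all other registers. -/
def liftParty (Z : Type) [DecidableEq Z] (i : Fin k)
    (W : Matrix (P.A i × P.M) (P.A i × P.M) ℂ) : Matrix (P.Basis Z) (P.Basis Z) ℂ :=
  Matrix.of fun x y =>
    if (∀ j, j ≠ i → x.1 j = y.1 j) ∧ x.2.2 = y.2.2 then W (x.1 i, x.2.1) (y.1 i, y.2.1) else 0

/-- The extension of an operator on the private register of party `i` to the joint space, acting as
the identity on all other registers. -/
def liftPrivate (Z : Type) [DecidableEq Z] (i : Fin k)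
    (W : Matrix (P.A i) (P.A i) ℂ) : Matrix (P.Basis Z) (P.Basis Z) ℂ :=
  Matrix.of fun x y =>
    if (∀ j, j ≠ i → x.1 j = y.1 j) ∧ x.2 = y.2 then W (x.1 i) (y.1 i) else 0

/-- The basis of the space that a coalition `D` of dishonest parties can act on: the private
registers of its members, the message register, and an auxiliary register with basis `Z`. -/
abbrev CoalitionBasis (D : Finset (Fin k)) (Z : Type) : Type :=
  ((j : {j // j ∈ D}) → P.A j.1) × P.M × Z

/-- The extension of an operator of the coalition `D` to the joint space, acting as the identity on
the private registers of the parties outside `D`. -/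
def liftCoalition (Z : Type) (D : Finset (Fin k))
    (W : Matrix (P.CoalitionBasis D Z) (P.CoalitionBasis D Z) ℂ) :
    Matrix (P.Basis Z) (P.Basis Z) ℂ :=
  Matrix.of fun x y =>
    if ∀ j, j ∉ D → x.1 j = y.1 j then
      W (fun j => x.1 j.1, x.2) (fun j => y.1 j.1, y.2)
    else 0

/-- The initial joint state, with the additional register in the basis state `z`. -/
def initState {Z : Type} [DecidableEq Z] (z : Z) : P.Basis Z → ℂ :=
  Pi.single (P.initA, P.initM, z) 1

/-- The joint state after the first `t` rounds when all parties are honest (and after all rounds,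
once `t ≥ N`). -/
def honestState : ℕ → P.Basis Unit → ℂ
  | 0 => P.initState ()
  | t + 1 =>
    if h : t < P.N then
      (P.liftParty Unit (P.turn ⟨t, h⟩) (P.U ⟨t, h⟩)).mulVec (honestState t)
    else honestState t

/-- A joint strategy of a coalition `D` of dishonest parties: they share an auxiliary register of
arbitrary finite dimension and apply, before every round, an arbitrary unitary to their private
registers, the message register and the auxiliary register. -/
structure Strategy (D : Finset (Fin k)) where
  Z : Type
  [fintypeZ : Fintype Z]
  [decEqZ : DecidableEq Z]
  initZ : Z
  V : Fin P.N → Matrix (P.CoalitionBasis D Z) (P.CoalitionBasis D Z) ℂ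
  V_unitary : ∀ t, V t ∈ Matrix.unitaryGroup (P.CoalitionBasis D Z) ℂ

attribute [instance] Strategy.fintypeZ Strategy.decEqZ

/-- The joint state after the first `t` rounds when the parties in `D` are dishonest and follow the
strategy `S`, while all other parties follow the protocol.  In each round the coalition acts first;
then the party whose turn it is applies its prescribed unitary if it is honest.  (What a dishonest
party does in its own turn is part of the action of the coalition.) -/
def cheatState {D : Finset (Fin k)} (S : P.Strategy D) : ℕ → P.Basis S.Z → ℂ
  | 0 => P.initState S.initZ
  | t + 1 =>
    if h : t < P.N then
      let φ := (P.liftCoalition S.Z D (S.V ⟨t, h⟩)).mulVec (cheatState S t)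
      if P.turn ⟨t, h⟩ ∈ D then φ
      else (P.liftParty S.Z (P.turn ⟨t, h⟩) (P.U ⟨t, h⟩)).mulVec φ
    else cheatState S t

/-- The probability that party `i` obtains outcome `b` when it measures the joint state `ψ`. -/
noncomputable def outcomeProb {Z : Type} [Fintype Z] [DecidableEq Z] (ψ : P.Basis Z → ℂ)
    (i : Fin k) (b : Bool) : ℝ :=
  ∑ x, ‖(P.liftPrivate Z i (P.proj i b)).mulVec ψ x‖ ^ 2

/-- `P` is a strong coin-flipping protocol with bias at most `ε`, against any number of dishonest
parties up to `k - 1`: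
* if all parties are honest, they obtain the same outcome, and each outcome has probability `1/2`
  (so that nobody aborts);
* if the parties in `D` are dishonest, then, whatever they do, no party outside `D` obtains a given
  outcome with probability larger than `1/2 + ε`. -/
structure IsStrongCoinFlip (ε : ℝ) : Prop where
  agree : ∀ (i i' : Fin k) (b : Bool),
    (P.liftPrivate Unit i (P.proj i b)).mulVec (P.honestState P.N) =
      (P.liftPrivate Unit i' (P.proj i' b)).mulVec (P.honestState P.N)
  fair : ∀ (i : Fin k) (b : Bool), P.outcomeProb (P.honestState P.N) i b = 1 / 2
  bias_le : ∀ (D : Finset (Fin k)) (S : P.Strategy D) (i : Fin k) (b : Bool), i ∉ D →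
    P.outcomeProb (P.cheatState S P.N) i b ≤ 1 / 2 + ε

end Protocol

end QuantumCoin

/-!
# A coin-flipping protocol for `k` parties with bias `1/2 - c/k`

The parties `0, …, n`, where `k = n + 1`, play king of the hill.  Party `0` is the first king; in
game `j` party `j + 1` challenges the present king and takes the crown with probability
`p = 1/(j + 2)`.  The last king tosses a coin and announces it.

In a game the king prepares `√(1 - x)|00⟩ + √x|11⟩` with `x = p + e` and `e = 1/(4k)`, and sends one
half to the challenger.  Having heard `1`, the challenger claims the crown with probability `p/x` and
else resigns; having heard `0`, it resigns.  A king whose bit is not `1` aborts when the crown is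
claimed.  So whatever the challenger does, an honest king loses the crown (without aborting) with
probability at most `x`.  Since `x` exceeds the honest probability `p` by `e` only, the crown of
game `j` remains worth about `j/k`: an honest party that holds it keeps it to the end, or aborts,
with probability of that order.  The excess `e` is what makes the challenger safe: when it resigns,
the two bits are left in a superposition with a weight of order `e` on `11`; the challenger asks for
the king's half and tests for this superposition, so that a king who always sends `0` is caught with
probability of order `e`, that is `1/k`; and a king who sends `1` loses a crown worth about `j/k` with
probability `p/x`.  No choice in between gives the cheating king more than `1 - 1/(12k)`
(`claim_bound`, `test_bound`).

Against a coalition, all that matters about an honest party `i` is what its own unitaries do to the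
squared norm of the joint state when each coordinate carries a weight depending on the basis state
of the private register of `i` (`potential`): the coalition and the other parties preserve it, and
the rounds of party `i` do not increase it for a suitable sequence of weights (`Safe`).  Such a
sequence is a diagonal solution of the dual of the semidefinite program for the coalition's optimal
strategy.  The weight `⊤` marks private states that the party cannot have reached yet.  Each round is a permutation of basis
states or a reflection of the private register (`Safe.perm`, `wnorm_refl_le_of_split`,
`wnorm_refl_le_of_merge`), and the weights of all rounds combine to `safe_allRounds`.

In an honest run the state between two games is a superposition of configurations with one king
(`run_game`, `configSpan`); histories with different former kings stay orthogonal, because a dethroned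
king remembers in which game it lost.  After the toss all parties hold the same bit, and the exchange
of the two bits leaves the state invariant (`IsFair`), which makes the outcomes equally likely.
-/

namespace QuantumCoin

open Matrix
open scoped ENNReal

/-! ### Weighted norms -/

/-- The squared norm of `φ` in which the coordinate `x` carries the weight `w x`.  A coordinate of
weight `⊤` is one on which `φ` has to vanish for the norm to be finite. -/
noncomputable def wnorm {X : Type*} [Fintype X] (w : X → ℝ≥0∞) (φ : X → ℂ) : ℝ≥0∞ :=
  ∑ x, w x * ‖φ x‖ₑ ^ 2

section wnorm

variable {X Y B : Type*} [Fintype X] [Fintype Y] [Fintype B]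

theorem wnorm_mono {w w' : X → ℝ≥0∞} (h : ∀ x, w' x ≤ w x) (φ : X → ℂ) :
    wnorm w' φ ≤ wnorm w φ :=
  Finset.sum_le_sum fun x _ => mul_le_mul_left (h x) _

theorem enorm_sq_eq_ofReal (z : ℂ) : ‖z‖ₑ ^ 2 = ENNReal.ofReal (‖z‖ ^ 2) := by
  rw [← ofReal_norm, ENNReal.ofReal_pow (norm_nonneg _)]

theorem wnorm_one (φ : X → ℂ) : wnorm (fun _ => 1) φ = ENNReal.ofReal (∑ x, ‖φ x‖ ^ 2) := by
  rw [wnorm, ENNReal.ofReal_sum_of_nonneg fun _ _ => by positivity]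
  exact Finset.sum_congr rfl fun x _ => by rw [one_mul, enorm_sq_eq_ofReal]

theorem wnorm_const_unitary [DecidableEq X] {U : Matrix X X ℂ} (hU : U ∈ unitaryGroup X ℂ)
    (c : ℝ≥0∞) (φ : X → ℂ) : wnorm (fun _ => c) (U *ᵥ φ) = wnorm (fun _ => c) φ := by
  have key : ∑ x, ‖(U *ᵥ φ) x‖ ^ 2 = ∑ x, ‖φ x‖ ^ 2 := by
    have h1 : ∀ χ : X → ℂ, ((∑ x, ‖χ x‖ ^ 2 : ℝ) : ℂ) = star χ ⬝ᵥ χ := by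
      intro χ
      simp only [dotProduct, Pi.star_apply, RCLike.star_def, Complex.conj_mul']
      push_cast
      rfl
    have h2 : star (U *ᵥ φ) ⬝ᵥ (U *ᵥ φ) = star φ ⬝ᵥ φ := by
      rw [star_mulVec, dotProduct_mulVec, vecMul_vecMul, ← star_eq_conjTranspose,
        mem_unitaryGroup_iff'.1 hU, vecMul_one]
    exact_mod_cast (h1 _).trans (h2.trans (h1 _).symm)
  have h3 : ∀ χ : X → ℂ, wnorm (fun _ => c) χ = c * ENNReal.ofReal (∑ x, ‖χ x‖ ^ 2) := by
    intro χ
    rw [← wnorm_one, wnorm, wnorm, Finset.mul_sum]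
    simp
  rw [h3, h3, key]

/-- An operator that acts as `U` on the first factor of `B ≃ X × Y` acts on each slice
separately. -/
theorem wnorm_mulVec_slice [DecidableEq Y] (e : B ≃ X × Y) {L : Matrix B B ℂ} {U : Matrix X X ℂ}
    (hL : ∀ a b, L a b = if (e a).2 = (e b).2 then U (e a).1 (e b).1 else 0) (w : B → ℝ≥0∞)
    (ψ : B → ℂ) :
    wnorm w (L *ᵥ ψ) =
      ∑ y, wnorm (fun x => w (e.symm (x, y))) (U *ᵥ fun x => ψ (e.symm (x, y))) := by
  have hv : ∀ x y, (L *ᵥ ψ) (e.symm (x, y)) = (U *ᵥ fun x => ψ (e.symm (x, y))) x := by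
    intro x y
    simp only [mulVec, dotProduct, hL, Equiv.apply_symm_apply]
    rw [← e.symm.sum_comp, Fintype.sum_prod_type]
    simp
  rw [wnorm, ← e.symm.sum_comp, Fintype.sum_prod_type, Finset.sum_comm]
  simp only [hv, wnorm]

theorem wnorm_eq_sum_slice (e : B ≃ X × Y) (w : B → ℝ≥0∞) (ψ : B → ℂ) :
    wnorm w ψ = ∑ y, wnorm (fun x => w (e.symm (x, y))) (fun x => ψ (e.symm (x, y))) := by
  rw [wnorm, ← e.symm.sum_comp, Fintype.sum_prod_type, Finset.sum_comm]
  simp only [wnorm]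

theorem wnorm_mulVec_slice_le [DecidableEq Y] (e : B ≃ X × Y) {L : Matrix B B ℂ}
    {U : Matrix X X ℂ}
    (hL : ∀ a b, L a b = if (e a).2 = (e b).2 then U (e a).1 (e b).1 else 0) {w w' : B → ℝ≥0∞}
    (h : ∀ y φ, wnorm (fun x => w' (e.symm (x, y))) (U *ᵥ φ) ≤
      wnorm (fun x => w (e.symm (x, y))) φ) (ψ : B → ℂ) :
    wnorm w' (L *ᵥ ψ) ≤ wnorm w ψ := by
  rw [wnorm_mulVec_slice e hL, wnorm_eq_sum_slice e]
  exact Finset.sum_le_sum fun y _ => h y _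

/-- A unitary that acts on the first factor preserves a norm whose weights depend on the second
factor only. -/
theorem wnorm_mulVec_slice_unitary [DecidableEq X] [DecidableEq Y] (e : B ≃ X × Y)
    {L : Matrix B B ℂ} {U : Matrix X X ℂ} (hU : U ∈ unitaryGroup X ℂ)
    (hL : ∀ a b, L a b = if (e a).2 = (e b).2 then U (e a).1 (e b).1 else 0) {w : B → ℝ≥0∞}
    {c : Y → ℝ≥0∞} (hw : ∀ x y, w (e.symm (x, y)) = c y) (ψ : B → ℂ) :
    wnorm w (L *ᵥ ψ) = wnorm w ψ := by
  rw [wnorm_mulVec_slice e hL, wnorm_eq_sum_slice e]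
  simp only [hw, wnorm_const_unitary hU]

end wnorm

/-! ### The joint space and its factors -/

section

variable {k : ℕ} {A M : Type} [DecidableEq A]

/-- The extension of an operator on one private register and the message register to the joint
space. -/
def lift {Z : Type} [DecidableEq Z] (i : Fin k) (W : Matrix (A × M) (A × M) ℂ) :
    Matrix ((Fin k → A) × M × Z) ((Fin k → A) × M × Z) ℂ :=
  Matrix.of fun x y =>
    if (∀ j, j ≠ i → x.1 j = y.1 j) ∧ x.2.2 = y.2.2 then W (x.1 i, x.2.1) (y.1 i, y.2.1) else 0

/-- The joint basis, split into what party `i` acts on in its turn and the rest. -/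
def splitParty (Z : Type) (i : Fin k) :
    ((Fin k → A) × M × Z) ≃ (A × M) × (({j // j ≠ i} → A) × Z) where
  toFun x := ((x.1 i, x.2.1), (fun j => x.1 j.1, x.2.2))
  invFun y := ((Equiv.funSplitAt i A).symm (y.1.1, y.2.1), y.1.2, y.2.2)
  left_inv x := by
    ext1
    · exact (Equiv.funSplitAt i A).symm_apply_apply x.1
    · rfl
  right_inv y := by
    have h := (Equiv.funSplitAt i A).apply_symm_apply (y.1.1, y.2.1)
    have h1 := congrArg Prod.fst h
    have h2 := congrArg Prod.snd h
    ext1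
    · exact Prod.ext h1 rfl
    · exact Prod.ext h2 rfl

theorem lift_apply_split {Z : Type} [DecidableEq Z] (i : Fin k) (W : Matrix (A × M) (A × M) ℂ)
    (x y : (Fin k → A) × M × Z) :
    lift i W x y = if (splitParty Z i x).2 = (splitParty Z i y).2 then
      W (splitParty Z i x).1 (splitParty Z i y).1 else 0 := by
  simp only [lift, of_apply, splitParty, Equiv.coe_fn_mk, Prod.mk.injEq, funext_iff,
    Subtype.forall]

/-- The joint basis, split into what the coalition `D` acts on and the rest. -/
def splitCoalition (M Z : Type) (D : Finset (Fin k)) :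
    ((Fin k → A) × M × Z) ≃ (({j // j ∈ D} → A) × M × Z) × ({j // j ∉ D} → A) where
  toFun x := ((fun j => x.1 j.1, x.2), fun j => x.1 j.1)
  invFun y := ((Equiv.piEquivPiSubtypeProd (· ∈ D) fun _ => A).symm (y.1.1, y.2), y.1.2)
  left_inv x := by
    ext1
    · exact (Equiv.piEquivPiSubtypeProd (· ∈ D) fun _ => A).symm_apply_apply x.1
    · rfl
  right_inv y := by
    have h := (Equiv.piEquivPiSubtypeProd (· ∈ D) fun _ => A).apply_symm_apply (y.1.1, y.2)
    have h1 := congrArg Prod.fst h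
    have h2 := congrArg Prod.snd h
    ext1
    · exact Prod.ext h1 rfl
    · exact h2

end

/-! ### Protocols given by a list of rounds -/

/-- One round: the party whose turn it is and its unitary.  All private registers have the same
basis `A`. -/
structure Round (k : ℕ) (A M : Type) [Fintype A] [DecidableEq A] [Fintype M] [DecidableEq M] where
  party : Fin k
  mat : Matrix (A × M) (A × M) ℂ
  unitary : mat ∈ unitaryGroup (A × M) ℂ

section

variable {k : ℕ} {A M : Type} [Fintype A] [DecidableEq A] [Fintype M] [DecidableEq M]

/-- The protocol that executes a list of rounds, and in which every party's outcome is read off the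
basis state of its private register: `val a = none` stands for an abort. -/
noncomputable def ofRounds (L : List (Round k A M)) (initA : Fin k → A) (initM : M)
    (val : A → Option Bool) : Protocol k where
  A := fun _ => A
  M := M
  initA := initA
  initM := initM
  N := L.length
  turn := fun t => (L.get t).party
  U := fun t => (L.get t).mat
  U_unitary := fun t => (L.get t).unitary
  proj := fun _ b => diagonal fun a => if val a = some b then 1 else 0
  proj_isStarProjection := fun _ b => by
    refine ⟨?_, ?_⟩
    · rw [IsIdempotentElem, diagonal_mul_diagonal]
      simp
    · rw [IsSelfAdjoint, star_eq_conjTranspose, diagonal_conjTranspose]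
      congr 1
      ext a
      simp only [Pi.star_apply]
      split_ifs <;> simp
  proj_orthogonal := fun _ => by
    rw [diagonal_mul_diagonal, ← diagonal_zero]
    congr 1
    ext a
    by_cases h : val a = some false <;> simp [h]

/-- The joint state after a list of rounds that are all executed honestly. -/
def run (L : List (Round k A M)) (ψ : (Fin k → A) × M × Unit → ℂ) :
    (Fin k → A) × M × Unit → ℂ :=
  L.foldl (fun ψ r => lift r.party r.mat *ᵥ ψ) ψ

theorem honestState_ofRounds (L : List (Round k A M)) (initA : Fin k → A) (initM : M)
    (val : A → Option Bool) :
    (ofRounds L initA initM val).honestState (ofRounds L initA initM val).N =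
      run L (Pi.single (initA, initM, ()) 1) := by
  have h : ∀ t ≤ L.length, (ofRounds L initA initM val).honestState t =
      run (L.take t) (Pi.single (initA, initM, ()) 1) := by
    intro t
    induction t with
    | zero => intro _; rfl
    | succ t ih =>
      intro ht
      have ht' : t < (ofRounds L initA initM val).N := ht
      rw [Protocol.honestState, dif_pos ht', ih (by omega), List.take_succ_eq_append_getElem ht,
        run, run, List.foldl_append]
      rfl
  have := h L.length le_rfl
  rwa [List.take_length] at this

theorem wnorm_one_run (L : List (Round k A M)) (ψ : (Fin k → A) × M × Unit → ℂ) :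
    wnorm (fun _ => 1) (run L ψ) = wnorm (fun _ => 1) ψ := by
  induction L generalizing ψ with
  | nil => rfl
  | cons r L ih =>
    rw [run, List.foldl_cons, ← run, ih]
    exact wnorm_mulVec_slice_unitary (splitParty Unit r.party) r.unitary (lift_apply_split _ _)
      (c := fun _ => 1) (fun _ _ => rfl) ψ

/-- The weighted norm of a joint state, with weights depending on the private register of
party `i`. -/
noncomputable def potential {Z : Type} [Fintype Z] (i : Fin k) (w : A → ℝ≥0∞)
    (ψ : (Fin k → A) × M × Z → ℂ) : ℝ≥0∞ :=
  wnorm (fun x => w (x.1 i)) ψ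

/-- `Safe i L w w'`: there are weights between the rounds of `L`, from `w` to `w'`, such that no
unitary of party `i` increases the weighted norm and that the weights decrease in the rounds of the
other parties.  The potential of party `i` then cannot increase from `w` to `w'`, whatever the other
parties do. -/
def Safe (i : Fin k) : List (Round k A M) → (A → ℝ≥0∞) → (A → ℝ≥0∞) → Prop
  | [], w, w' => ∀ a, w' a ≤ w a
  | r :: L, w, w' => ∃ v : A → ℝ≥0∞,
      (if r.party = i then
        ∀ φ, wnorm (fun y : A × M => v y.1) (r.mat *ᵥ φ) ≤ wnorm (fun y => w y.1) φ
      else ∀ a, v a ≤ w a) ∧ Safe i L v w'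

theorem Safe.mono_left {i : Fin k} {L : List (Round k A M)} {u w w' : A → ℝ≥0∞}
    (h : Safe i L w w') (hu : ∀ a, w a ≤ u a) : Safe i L u w' := by
  cases L with
  | nil => exact fun a => (h a).trans (hu a)
  | cons r L =>
    obtain ⟨v, hv, hL⟩ := h
    refine ⟨v, ?_, hL⟩
    split_ifs at hv ⊢
    · exact fun φ => (hv φ).trans (wnorm_mono (fun y => hu y.1) φ)
    · exact fun a => (hv a).trans (hu a)

theorem Safe.append {i : Fin k} {L L' : List (Round k A M)} {u v w : A → ℝ≥0∞}
    (h : Safe i L u v) (h' : Safe i L' v w) : Safe i (L ++ L') u w := by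
  induction L generalizing u with
  | nil => exact h'.mono_left h
  | cons r L ih =>
    obtain ⟨v', hv, hL⟩ := h
    exact ⟨v', hv, ih hL⟩

theorem Safe.of_ne {i : Fin k} {L : List (Round k A M)} (hL : ∀ r ∈ L, r.party ≠ i)
    (w : A → ℝ≥0∞) : Safe i L w w := by
  induction L with
  | nil => exact fun _ => le_rfl
  | cons r L ih =>
    refine ⟨w, ?_, ih fun r hr => hL r (List.mem_cons_of_mem _ hr)⟩
    rw [if_neg (hL r List.mem_cons_self)]
    exact fun _ => le_rfl

theorem potential_coalition {Z : Type} [Fintype Z] [DecidableEq Z] (L : List (Round k A M))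
    (initA : Fin k → A) (initM : M) (val : A → Option Bool) {D : Finset (Fin k)} {i : Fin k}
    (hi : i ∉ D) {V : Matrix (({j // j ∈ D} → A) × M × Z) (({j // j ∈ D} → A) × M × Z) ℂ}
    (hV : V ∈ unitaryGroup _ ℂ) (w : A → ℝ≥0∞) (ψ : (Fin k → A) × M × Z → ℂ) :
    potential i w ((ofRounds L initA initM val).liftCoalition Z D V *ᵥ ψ) = potential i w ψ := by
  refine wnorm_mulVec_slice_unitary (splitCoalition M Z D) hV ?_ (c := fun y => w (y ⟨i, hi⟩))
    ?_ ψ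
  · intro a b
    change (if ∀ j, j ∉ D → a.1 j = b.1 j then _ else _) = _
    simp only [splitCoalition, Equiv.coe_fn_mk, funext_iff, Subtype.forall]
    rfl
  · intro x y
    congr 1
    exact congrFun (congrArg Prod.snd ((splitCoalition M Z D).apply_symm_apply (x, y))) ⟨i, hi⟩

theorem potential_lift_of_ne {Z : Type} [Fintype Z] [DecidableEq Z] {i : Fin k}
    (r : Round k A M) (hr : r.party ≠ i) (w : A → ℝ≥0∞) (ψ : (Fin k → A) × M × Z → ℂ) :
    potential i w (lift r.party r.mat *ᵥ ψ) = potential i w ψ := by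
  refine wnorm_mulVec_slice_unitary (splitParty Z r.party) r.unitary (lift_apply_split _ _)
    (c := fun y => w (y.1 ⟨i, hr.symm⟩)) ?_ ψ
  intro x y
  congr 1
  exact congrFun (congrArg (fun z : (A × M) × (({j // j ≠ r.party} → A) × Z) => z.2.1)
    ((splitParty Z r.party).apply_symm_apply (x, y)))
    ⟨i, hr.symm⟩

theorem potential_lift_le {Z : Type} [Fintype Z] [DecidableEq Z] (r : Round k A M)
    {v w : A → ℝ≥0∞}
    (h : ∀ φ, wnorm (fun y : A × M => v y.1) (r.mat *ᵥ φ) ≤ wnorm (fun y => w y.1) φ)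
    (ψ : (Fin k → A) × M × Z → ℂ) :
    potential r.party v (lift r.party r.mat *ᵥ ψ) ≤ potential r.party w ψ := by
  refine wnorm_mulVec_slice_le (splitParty Z r.party) (lift_apply_split _ _) ?_ ψ
  intro y φ
  have e : ∀ x, ((splitParty Z r.party).symm (x, y)).1 r.party = x.1 := fun x =>
    congrArg (fun z : (A × M) × (({j // j ≠ r.party} → A) × Z) => z.1.1)
      ((splitParty Z r.party).apply_symm_apply (x, y))
  simp only [e]
  exact h φ

/-- Against every strategy of a coalition, the final potential of an honest party is at most the
weight of its initial state. -/
theorem potential_cheatState_le (L : List (Round k A M)) (initA : Fin k → A) (initM : M)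
    (val : A → Option Bool) {D : Finset (Fin k)}
    (S : (ofRounds L initA initM val).Strategy D) {i : Fin k} (hi : i ∉ D) {w w' : A → ℝ≥0∞}
    (h : Safe i L w w') :
    potential i w' ((ofRounds L initA initM val).cheatState S L.length) ≤ w (initA i) := by
  have key : ∀ m t, t + m = L.length → ∀ v, Safe i (L.drop t) v w' →
      potential i w' ((ofRounds L initA initM val).cheatState S L.length) ≤
        potential i v ((ofRounds L initA initM val).cheatState S t) := by
    intro m
    induction m with
    | zero =>
      intro t ht v hs
      obtain rfl : t = L.length := by omega
      rw [List.drop_length] at hs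
      exact wnorm_mono (fun x => hs _) _
    | succ m ih =>
      intro t ht v hs
      have htl : t < L.length := by omega
      have htN : t < (ofRounds L initA initM val).N := htl
      rw [List.drop_eq_getElem_cons htl] at hs
      obtain ⟨u, hu, hs⟩ := hs
      refine (ih (t + 1) (by omega) u hs).trans ?_
      rw [Protocol.cheatState, dif_pos htN]
      have hc := potential_coalition L initA initM val hi (S.V_unitary ⟨t, htl⟩) v
        ((ofRounds L initA initM val).cheatState S t)
      refine le_trans ?_ hc.le
      split_ifs at hu with hp
      · have hD : (ofRounds L initA initM val).turn ⟨t, htN⟩ ∉ D := fun hD => hi (hp ▸ hD)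
        rw [if_neg hD]
        subst hp
        exact potential_lift_le L[t] hu _
      · refine le_trans ?_ (wnorm_mono (fun x => hu _) _)
        split_ifs with hD
        · exact le_rfl
        · exact (potential_lift_of_ne L[t] hp u _).le
  refine (key L.length 0 (by omega) w (by simpa using h)).trans ?_
  change ∑ x : (Fin k → A) × M × S.Z, w (x.1 i) *
    ‖(Pi.single (initA, initM, S.initZ) 1 : (Fin k → A) × M × S.Z → ℂ) x‖ₑ ^ 2 ≤ _
  rw [Finset.sum_eq_single (initA, initM, S.initZ)]
  · simp
  · intro b _ hb
    rw [Pi.single_eq_of_ne hb]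
    simp
  · simp

theorem liftPrivate_ofRounds (L : List (Round k A M)) (initA : Fin k → A) (initM : M)
    (val : A → Option Bool) {Z : Type} [Fintype Z] [DecidableEq Z] (i : Fin k) (b : Bool)
    (ψ : (Fin k → A) × M × Z → ℂ) (x : (Fin k → A) × M × Z) :
    ((ofRounds L initA initM val).liftPrivate Z i
      ((ofRounds L initA initM val).proj i b) *ᵥ ψ) x =
      if val (x.1 i) = some b then ψ x else 0 := by
  change ∑ y : (Fin k → A) × M × Z, (if (∀ j, j ≠ i → x.1 j = y.1 j) ∧ x.2 = y.2 then
    diagonal (fun a => if val a = some b then (1 : ℂ) else 0) (x.1 i) (y.1 i) else 0) * ψ y = _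
  rw [Finset.sum_eq_single x]
  · simp
  · intro y _ hy
    rw [mul_eq_zero]
    left
    split_ifs with h
    · refine diagonal_apply_ne _ fun hxy => hy (Prod.ext ?_ h.2.symm)
      funext j
      by_cases hj : j = i
      · rw [hj, hxy]
      · exact (h.1 j hj).symm
    · rfl
  · simp

theorem outcomeProb_ofRounds (L : List (Round k A M)) (initA : Fin k → A) (initM : M)
    (val : A → Option Bool) {Z : Type} [Fintype Z] [DecidableEq Z] (i : Fin k) (b : Bool)
    (ψ : (Fin k → A) × M × Z → ℂ) :
    ENNReal.ofReal ((ofRounds L initA initM val).outcomeProb ψ i b) =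
      potential i (fun a => if val a = some b then 1 else 0) ψ := by
  refine (ENNReal.ofReal_sum_of_nonneg fun _ _ => by positivity).trans ?_
  refine Finset.sum_congr rfl fun x _ => ?_
  rw [← enorm_sq_eq_ofReal]
  refine (congrArg (fun z : ℂ => ‖z‖ₑ ^ 2)
    (liftPrivate_ofRounds L initA initM val i b ψ x)).trans ?_
  change _ = (if val (x.1 i) = some b then 1 else 0) * ‖ψ x‖ₑ ^ 2
  split_ifs <;> simp

end

/-! ### Elementary rounds -/

section reflVec

variable {A : Type} [DecidableEq A] {a₀ a₁ a₂ : A} {α β : ℝ}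

/-- The vector `e a₀ - α e a₁ - β e a₂`, of squared length `2`. -/
def reflVec (a₀ a₁ a₂ : A) (α β : ℝ) (a : A) : ℂ :=
  if a = a₀ then 1 else if a = a₁ then -α else if a = a₂ then -β else 0

theorem reflVec_zero : reflVec a₀ a₁ a₂ α β a₀ = 1 := by simp [reflVec]

theorem reflVec_one (h01 : a₀ ≠ a₁) : reflVec a₀ a₁ a₂ α β a₁ = -α := by
  simp [reflVec, h01.symm]

theorem reflVec_two (h02 : a₀ ≠ a₂) (h12 : a₁ ≠ a₂) : reflVec a₀ a₁ a₂ α β a₂ = -β := by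
  simp [reflVec, h02.symm, h12.symm]

theorem reflVec_of_ne {a : A} (h0 : a ≠ a₀) (h1 : a ≠ a₁) (h2 : a ≠ a₂) :
    reflVec a₀ a₁ a₂ α β a = 0 := by
  simp [reflVec, h0, h1, h2]

end reflVec

section

variable {k : ℕ} {A M : Type} [Fintype A] [DecidableEq A] [Fintype M] [DecidableEq M]

/-- The round in which party `i` permutes the basis states of its private register and the message
register. -/
noncomputable def permRound (i : Fin k) (f : Equiv.Perm (A × M)) : Round k A M where
  party := i
  mat := Matrix.of fun x y => if x = f y then 1 else 0
  unitary := by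
    rw [mem_unitaryGroup_iff]
    ext x y
    rw [mul_apply, ← f.symm.sum_comp]
    simp [one_apply, star_apply]

/-- The reflection that exchanges the basis vector `e a₀` and the unit vector
`α e a₁ + β e a₂`. -/
def refl (a₀ a₁ a₂ : A) (α β : ℝ) : Matrix A A ℂ :=
  1 - vecMulVec (reflVec a₀ a₁ a₂ α β) (reflVec a₀ a₁ a₂ α β)

section refl

variable {a₀ a₁ a₂ : A} {α β : ℝ}

theorem sum_reflVec {E : Type*} [AddCommGroup E] [Module ℂ E] (h01 : a₀ ≠ a₁) (h02 : a₀ ≠ a₂)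
    (h12 : a₁ ≠ a₂) (g : A → E) :
    ∑ a, reflVec a₀ a₁ a₂ α β a • g a = g a₀ - ((α : ℂ) • g a₁ + (β : ℂ) • g a₂) := by
  rw [← Finset.sum_subset (Finset.subset_univ {a₀, a₁, a₂})]
  · rw [Finset.sum_insert (by simp [h01, h02]), Finset.sum_insert (by simp [h12]),
      Finset.sum_singleton, reflVec_zero, reflVec_one h01, reflVec_two h02 h12]
    module
  · intro a _ ha
    simp only [Finset.mem_insert, Finset.mem_singleton, not_or] at ha
    rw [reflVec_of_ne ha.1 ha.2.1 ha.2.2, zero_smul]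

theorem reflVec_dotProduct (h01 : a₀ ≠ a₁) (h02 : a₀ ≠ a₂) (h12 : a₁ ≠ a₂) (φ : A → ℂ) :
    reflVec a₀ a₁ a₂ α β ⬝ᵥ φ = φ a₀ - (α * φ a₁ + β * φ a₂) :=
  sum_reflVec h01 h02 h12 φ

theorem refl_mem_unitaryGroup (h01 : a₀ ≠ a₁) (h02 : a₀ ≠ a₂) (h12 : a₁ ≠ a₂)
    (h : α ^ 2 + β ^ 2 = 1) : refl a₀ a₁ a₂ α β ∈ unitaryGroup A ℂ := by
  have hs : star (refl a₀ a₁ a₂ α β) = refl a₀ a₁ a₂ α β := by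
    have hv : star (reflVec a₀ a₁ a₂ α β) = reflVec a₀ a₁ a₂ α β := by
      funext a
      simp only [Pi.star_apply, reflVec]
      split_ifs <;> simp
    rw [refl, star_sub, star_one, star_eq_conjTranspose, conjTranspose_vecMulVec, hv]
  have hd : reflVec a₀ a₁ a₂ α β ⬝ᵥ reflVec a₀ a₁ a₂ α β = 2 := by
    rw [reflVec_dotProduct h01 h02 h12, reflVec_zero, reflVec_one h01, reflVec_two h02 h12]
    have h' : (α : ℂ) ^ 2 + (β : ℂ) ^ 2 = 1 := by exact_mod_cast h
    linear_combination h'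
  rw [mem_unitaryGroup_iff, hs, refl, mul_sub, mul_one, sub_mul, one_mul,
    vecMulVec_mul_vecMulVec, hd, two_smul, vecMulVec_add]
  abel

theorem refl_mulVec (h01 : a₀ ≠ a₁) (h02 : a₀ ≠ a₂) (h12 : a₁ ≠ a₂) (φ : A → ℂ) (a : A) :
    (refl a₀ a₁ a₂ α β *ᵥ φ) a =
      φ a - reflVec a₀ a₁ a₂ α β a * (φ a₀ - (α * φ a₁ + β * φ a₂)) := by
  rw [refl, sub_mulVec, one_mulVec, vecMulVec_mulVec, reflVec_dotProduct h01 h02 h12]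
  simp [mul_comm]

theorem wnorm_refl_le (h01 : a₀ ≠ a₁) (h02 : a₀ ≠ a₂) (h12 : a₁ ≠ a₂) {w w' : A → ℝ≥0∞}
    (hw : ∀ a, a ≠ a₀ → a ≠ a₁ → a ≠ a₂ → w' a ≤ w a)
    (h : ∀ x y z : ℂ, w' a₀ * ‖α * y + β * z‖ₑ ^ 2 +
        (w' a₁ * ‖y + α * (x - (α * y + β * z))‖ₑ ^ 2 +
          w' a₂ * ‖z + β * (x - (α * y + β * z))‖ₑ ^ 2) ≤
      w a₀ * ‖x‖ₑ ^ 2 + (w a₁ * ‖y‖ₑ ^ 2 + w a₂ * ‖z‖ₑ ^ 2)) (φ : A → ℂ) :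
    wnorm w' (refl a₀ a₁ a₂ α β *ᵥ φ) ≤ wnorm w φ := by
  rw [wnorm, wnorm, ← Finset.sum_add_sum_compl {a₀, a₁, a₂},
    ← Finset.sum_add_sum_compl {a₀, a₁, a₂} fun a => w a * ‖φ a‖ₑ ^ 2]
  refine add_le_add ?_ (Finset.sum_le_sum fun a ha => ?_)
  · simp only [Finset.sum_insert (show a₀ ∉ ({a₁, a₂} : Finset A) by simp [h01, h02]),
      Finset.sum_insert (show a₁ ∉ ({a₂} : Finset A) by simp [h12]), Finset.sum_singleton,
      refl_mulVec h01 h02 h12, reflVec_zero, reflVec_one h01, reflVec_two h02 h12]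
    have e0 : φ a₀ - 1 * (φ a₀ - (α * φ a₁ + β * φ a₂)) = α * φ a₁ + β * φ a₂ := by ring
    rw [e0, neg_mul, neg_mul, sub_neg_eq_add, sub_neg_eq_add]
    exact h (φ a₀) (φ a₁) (φ a₂)
  · simp only [Finset.mem_compl, Finset.mem_insert, Finset.mem_singleton, not_or] at ha
    rw [refl_mulVec h01 h02 h12, reflVec_of_ne ha.1 ha.2.1 ha.2.2, zero_mul, sub_zero]
    exact mul_le_mul_left (hw a ha.1 ha.2.1 ha.2.2) _

/-- If `a₁` and `a₂` are unoccupied, then the reflection splits the weight on `a₀`. -/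
theorem wnorm_refl_le_of_split (h01 : a₀ ≠ a₁) (h02 : a₀ ≠ a₂) (h12 : a₁ ≠ a₂)
    {w w' : A → ℝ≥0∞} (hw : ∀ a, a ≠ a₀ → a ≠ a₁ → a ≠ a₂ → w' a ≤ w a)
    (h1 : w a₁ = ⊤) (h2 : w a₂ = ⊤)
    (h : w' a₁ * ENNReal.ofReal (α ^ 2) + w' a₂ * ENNReal.ofReal (β ^ 2) ≤ w a₀) (φ : A → ℂ) :
    wnorm w' (refl a₀ a₁ a₂ α β *ᵥ φ) ≤ wnorm w φ := by
  refine wnorm_refl_le h01 h02 h12 hw (fun x y z => ?_) φ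
  by_cases hy : y = 0
  · by_cases hz : z = 0
    · subst hy hz
      have e : ∀ (γ : ℝ) (x : ℂ), ‖(γ : ℂ) * x‖ₑ ^ 2 = ENNReal.ofReal (γ ^ 2) * ‖x‖ₑ ^ 2 := by
        intro γ x
        rw [enorm_sq_eq_ofReal, enorm_sq_eq_ofReal, norm_mul, mul_pow,
          ENNReal.ofReal_mul (by positivity), Complex.norm_real, Real.norm_eq_abs, sq_abs]
      simp only [mul_zero, add_zero, zero_add, sub_zero, e, enorm_zero, ne_eq,
        OfNat.ofNat_ne_zero, not_false_eq_true, zero_pow]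
      rw [← mul_assoc, ← mul_assoc, ← add_mul]
      exact mul_le_mul_left h _
    · rw [h2, ENNReal.top_mul (a := ‖z‖ₑ ^ 2) (by simpa using hz)]
      simp
  · rw [h1, ENNReal.top_mul (a := ‖y‖ₑ ^ 2) (by simpa using hy)]
    simp

/-- The reflection passes to `a₀` only what is parallel to `α e a₁ + β e a₂`, whose norm is bounded
by the Cauchy-Schwarz inequality. -/
theorem wnorm_refl_le_of_merge (h01 : a₀ ≠ a₁) (h02 : a₀ ≠ a₂) (h12 : a₁ ≠ a₂)
    {w w' : A → ℝ≥0∞} (hw : ∀ a, a ≠ a₀ → a ≠ a₁ → a ≠ a₂ → w' a ≤ w a)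
    (h1 : w' a₁ = 0) (h2 : w' a₂ = 0) {p q r : ℝ} (hp : 0 < p) (hq : 0 < q)
    (hr : 0 ≤ r) (hwp : w a₁ = ENNReal.ofReal p) (hwq : w a₂ = ENNReal.ofReal q)
    (hwr : w' a₀ = ENNReal.ofReal r)
    (h : r * (α ^ 2 / p + β ^ 2 / q) ≤ 1) (φ : A → ℂ) :
    wnorm w' (refl a₀ a₁ a₂ α β *ᵥ φ) ≤ wnorm w φ := by
  refine wnorm_refl_le h01 h02 h12 hw (fun x y z => ?_) φ
  rw [h1, h2, zero_mul, zero_mul, add_zero, add_zero, hwp, hwq, hwr]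
  refine le_trans ?_ le_add_self
  simp only [enorm_sq_eq_ofReal]
  rw [← ENNReal.ofReal_mul hr, ← ENNReal.ofReal_mul hp.le, ← ENNReal.ofReal_mul hq.le,
    ← ENNReal.ofReal_add (by positivity) (by positivity)]
  refine ENNReal.ofReal_le_ofReal ?_
  have hn : ‖(α : ℂ) * y + β * z‖ ≤ |α| * ‖y‖ + |β| * ‖z‖ := by
    refine (norm_add_le _ _).trans ?_
    rw [norm_mul, norm_mul, Complex.norm_real, Complex.norm_real, Real.norm_eq_abs,
      Real.norm_eq_abs]
  have hcs : (|α| * ‖y‖ + |β| * ‖z‖) ^ 2 ≤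
      (α ^ 2 / p + β ^ 2 / q) * (p * ‖y‖ ^ 2 + q * ‖z‖ ^ 2) := by
    rw [← sub_nonneg]
    have : (α ^ 2 / p + β ^ 2 / q) * (p * ‖y‖ ^ 2 + q * ‖z‖ ^ 2) -
        (|α| * ‖y‖ + |β| * ‖z‖) ^ 2 = (|α| * q * ‖z‖ - |β| * p * ‖y‖) ^ 2 / (p * q) := by
      rw [← sq_abs α, ← sq_abs β]
      field_simp
      ring
    rw [this]
    positivity
  calc r * ‖(α : ℂ) * y + β * z‖ ^ 2 ≤ r * (|α| * ‖y‖ + |β| * ‖z‖) ^ 2 := by gcongr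
    _ ≤ r * ((α ^ 2 / p + β ^ 2 / q) * (p * ‖y‖ ^ 2 + q * ‖z‖ ^ 2)) := by gcongr
    _ = (r * (α ^ 2 / p + β ^ 2 / q)) * (p * ‖y‖ ^ 2 + q * ‖z‖ ^ 2) := by ring
    _ ≤ 1 * (p * ‖y‖ ^ 2 + q * ‖z‖ ^ 2) := by gcongr
    _ = _ := one_mul _

end refl

/-- The round in which party `i` applies to its private register the reflection that exchanges
`e a₀` and `α e a₁ + β e a₂`. -/
noncomputable def reflRound (i : Fin k) (a₀ a₁ a₂ : A) (α β : ℝ) (h01 : a₀ ≠ a₁) (h02 : a₀ ≠ a₂)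
    (h12 : a₁ ≠ a₂) (h : α ^ 2 + β ^ 2 = 1) : Round k A M where
  party := i
  mat := kroneckerMap (· * ·) (refl a₀ a₁ a₂ α β) 1
  unitary := kronecker_mem_unitary (refl_mem_unitaryGroup h01 h02 h12 h) (one_mem _)

/-! ### Potential change in elementary rounds -/

theorem Safe.perm (i : Fin k) (f : Equiv.Perm (A × M)) {w w' : A → ℝ≥0∞}
    (h : ∀ a m, w' (f (a, m)).1 ≤ w a) : Safe i [permRound i f] w w' := by
  refine ⟨w', (if_pos (show (permRound i f).party = i from rfl)).symm ▸ fun φ => ?_,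
    fun _ => le_rfl⟩
  rw [wnorm, ← Equiv.sum_comp f, wnorm]
  refine Finset.sum_le_sum fun y _ => ?_
  have : ((permRound i f).mat *ᵥ φ) (f y) = φ y := by
    simp [permRound, mulVec, dotProduct]
  rw [this]
  exact mul_le_mul_left (h y.1 y.2) _

theorem Safe.refl_of_le (i : Fin k) {a₀ a₁ a₂ : A} {α β : ℝ} (h01 : a₀ ≠ a₁) (h02 : a₀ ≠ a₂)
    (h12 : a₁ ≠ a₂) (hαβ : α ^ 2 + β ^ 2 = 1) {w w' : A → ℝ≥0∞}
    (h : ∀ φ, wnorm w' (refl a₀ a₁ a₂ α β *ᵥ φ) ≤ wnorm w φ) :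
    Safe i [(reflRound i a₀ a₁ a₂ α β h01 h02 h12 hαβ : Round k A M)] w w' := by
  refine ⟨w', (if_pos (show (reflRound i a₀ a₁ a₂ α β h01 h02 h12 hαβ : Round k A M).party = i
    from rfl)).symm ▸ fun φ => ?_, fun _ => le_rfl⟩
  have e : ∀ a m, ((reflRound i a₀ a₁ a₂ α β h01 h02 h12 hαβ : Round k A M).mat *ᵥ φ) (a, m) =
      (refl a₀ a₁ a₂ α β *ᵥ fun a => φ (a, m)) a := by
    intro a m
    simp only [reflRound, mulVec, dotProduct, Fintype.sum_prod_type, kroneckerMap_apply, one_apply]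
    simp
  rw [wnorm, wnorm, Fintype.sum_prod_type_right, Fintype.sum_prod_type_right]
  refine Finset.sum_le_sum fun m _ => ?_
  simp only [e]
  exact h fun a => φ (a, m)

/-! ### Elementary rounds on basis states -/

/-- The basis state with private registers `σ` and message `m`. -/
def ket (σ : Fin k → A) (m : M) : (Fin k → A) × M × Unit → ℂ := Pi.single (σ, m, ()) 1

theorem run_nil (ψ : (Fin k → A) × M × Unit → ℂ) : run ([] : List (Round k A M)) ψ = ψ := rfl

theorem run_cons (r : Round k A M) (L : List (Round k A M)) (ψ : (Fin k → A) × M × Unit → ℂ) :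
    run (r :: L) ψ = run L (run [r] ψ) := rfl

theorem run_append (L L' : List (Round k A M)) (ψ : (Fin k → A) × M × Unit → ℂ) :
    run (L ++ L') ψ = run L' (run L ψ) := List.foldl_append ..

theorem run_add (L : List (Round k A M)) (ψ χ : (Fin k → A) × M × Unit → ℂ) :
    run L (ψ + χ) = run L ψ + run L χ := by
  induction L generalizing ψ χ with
  | nil => rfl
  | cons r L ih =>
    rw [run_cons, run_cons _ _ ψ, run_cons _ _ χ, ← ih]
    congr 1
    exact mulVec_add ..

theorem run_smul (L : List (Round k A M)) (c : ℂ) (ψ : (Fin k → A) × M × Unit → ℂ) :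
    run L (c • ψ) = c • run L ψ := by
  induction L generalizing ψ with
  | nil => rfl
  | cons r L ih =>
    rw [run_cons, run_cons _ _ ψ, ← ih]
    congr 1
    exact mulVec_smul ..

theorem run_singleton_ket (r : Round k A M) (σ : Fin k → A) (m : M) :
    run [r] (ket σ m) =
      ∑ y : A × M, r.mat y (σ r.party, m) • ket (Function.update σ r.party y.1) y.2 := by
  change lift r.party r.mat *ᵥ Pi.single (σ, m, ()) 1 = _
  funext x
  rw [mulVec_single_one, Finset.sum_apply, Finset.sum_eq_single (x.1 r.party, x.2.1)]
  · simp only [col_apply, lift, of_apply, and_true, Pi.smul_apply, ket, smul_eq_mul]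
    by_cases h : ∀ j, j ≠ r.party → x.1 j = σ j
    · have : x = (Function.update σ r.party (x.1 r.party), x.2.1, ()) := by
        refine Prod.ext (funext fun j => ?_) rfl
        by_cases hj : j = r.party
        · subst hj
          simp
        · simp [hj, h j hj]
      rw [if_pos h]
      conv_rhs => rw [this]
      simp
    · rw [if_neg h, Pi.single_eq_of_ne, mul_zero]
      intro hx
      refine h fun j hj => ?_
      exact (congrFun (congrArg Prod.fst hx) j).trans (Function.update_of_ne hj ..)
  · rintro ⟨a, m'⟩ _ hy
    rw [Pi.smul_apply, ket, Pi.single_eq_of_ne, smul_zero]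
    intro hx
    refine hy (Prod.ext ?_ ?_)
    · simp [hx]
    · simp [hx]
  · simp

theorem run_perm_ket (i : Fin k) (f : Equiv.Perm (A × M)) (σ : Fin k → A) (m : M) :
    run [permRound i f] (ket σ m) =
      ket (Function.update σ i (f (σ i, m)).1) (f (σ i, m)).2 := by
  rw [run_singleton_ket]
  simp [permRound]

theorem run_refl_ket (i : Fin k) {a₀ a₁ a₂ : A} {α β : ℝ} (h01 : a₀ ≠ a₁) (h02 : a₀ ≠ a₂)
    (h12 : a₁ ≠ a₂) (h : α ^ 2 + β ^ 2 = 1) (σ : Fin k → A) (m : M) :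
    run [(reflRound i a₀ a₁ a₂ α β h01 h02 h12 h : Round k A M)] (ket σ m) =
      ket σ m - reflVec a₀ a₁ a₂ α β (σ i) • (ket (Function.update σ i a₀) m -
        ((α : ℂ) • ket (Function.update σ i a₁) m + (β : ℂ) • ket (Function.update σ i a₂) m)) := by
  rw [run_singleton_ket, Fintype.sum_prod_type,
    ← sum_reflVec h01 h02 h12 fun a => ket (Function.update σ i a) m]
  have e : ∀ a m', (reflRound i a₀ a₁ a₂ α β h01 h02 h12 h : Round k A M).mat (a, m') (σ i, m) =
      if m' = m then ((1 : Matrix A A ℂ) a (σ i) -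
        reflVec a₀ a₁ a₂ α β a * reflVec a₀ a₁ a₂ α β (σ i)) else 0 := by
    intro a m'
    simp [reflRound, kroneckerMap_apply, one_apply, refl, vecMulVec_apply]
  simp only [show (reflRound i a₀ a₁ a₂ α β h01 h02 h12 h : Round k A M).party = i from rfl, e,
    ite_smul, zero_smul, Finset.sum_ite_eq', Finset.mem_univ, if_true, sub_smul,
    Finset.sum_sub_distrib]
  congr 1
  · simp [one_apply]
  · rw [Finset.smul_sum]
    exact Finset.sum_congr rfl fun a _ => by rw [smul_smul, mul_comm]

theorem run_refl_ket_of_ne (i : Fin k) {a₀ a₁ a₂ : A} {α β : ℝ} (h01 : a₀ ≠ a₁) (h02 : a₀ ≠ a₂)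
    (h12 : a₁ ≠ a₂) (h : α ^ 2 + β ^ 2 = 1) {σ : Fin k → A} (m : M) (h0 : σ i ≠ a₀)
    (h1 : σ i ≠ a₁) (h2 : σ i ≠ a₂) :
    run [(reflRound i a₀ a₁ a₂ α β h01 h02 h12 h : Round k A M)] (ket σ m) = ket σ m := by
  rw [run_refl_ket, reflVec_of_ne h0 h1 h2, zero_smul, sub_zero]

theorem run_refl_ket_split (i : Fin k) {a₀ a₁ a₂ : A} {α β : ℝ} (h01 : a₀ ≠ a₁) (h02 : a₀ ≠ a₂)
    (h12 : a₁ ≠ a₂) (h : α ^ 2 + β ^ 2 = 1) {σ : Fin k → A} (m : M) (h0 : σ i = a₀) :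
    run [(reflRound i a₀ a₁ a₂ α β h01 h02 h12 h : Round k A M)] (ket σ m) =
      (α : ℂ) • ket (Function.update σ i a₁) m + (β : ℂ) • ket (Function.update σ i a₂) m := by
  rw [run_refl_ket, h0, reflVec_zero, ← h0, Function.update_eq_self, one_smul, sub_sub_cancel]

theorem run_refl_ket_merge (i : Fin k) {a₀ a₁ a₂ : A} {α β : ℝ} (h01 : a₀ ≠ a₁) (h02 : a₀ ≠ a₂)
    (h12 : a₁ ≠ a₂) (h : α ^ 2 + β ^ 2 = 1) (σ : Fin k → A) (m : M) :
    run [(reflRound i a₀ a₁ a₂ α β h01 h02 h12 h : Round k A M)]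
      ((α : ℂ) • ket (Function.update σ i a₁) m + (β : ℂ) • ket (Function.update σ i a₂) m) =
      ket (Function.update σ i a₀) m := by
  have h' : (α : ℂ) ^ 2 + (β : ℂ) ^ 2 = 1 := by exact_mod_cast h
  rw [run_add, run_smul, run_smul, run_refl_ket, run_refl_ket, Function.update_self,
    Function.update_self, reflVec_one h01, reflVec_two h02 h12]
  simp only [Function.update_idem]
  generalize ket (Function.update σ i a₀) m = u
  generalize ket (Function.update σ i a₁) m = v
  generalize ket (Function.update σ i a₂) m = t
  have : (α : ℂ) • (v - -(α : ℂ) • (u - ((α : ℂ) • v + (β : ℂ) • t))) +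
      (β : ℂ) • (t - -(β : ℂ) • (u - ((α : ℂ) • v + (β : ℂ) • t))) =
      ((α : ℂ) ^ 2 + (β : ℂ) ^ 2) • (u - ((α : ℂ) • v + (β : ℂ) • t)) +
        ((α : ℂ) • v + (β : ℂ) • t) := by module
  rw [this, h', one_smul, sub_add_cancel]

/-! ### Sweeps -/

/-- Every party executes its part `prog i` once, in the order of the parties. -/
def sweep (prog : Fin k → List (Round k A M)) : List (Round k A M) :=
  (List.finRange k).flatMap prog

theorem exists_finRange_eq (l : Fin k) :
    ∃ s t, List.finRange k = s ++ l :: t ∧ l ∉ s ∧ l ∉ t := by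
  obtain ⟨s, t, h⟩ := List.append_of_mem (List.mem_finRange l)
  have hn := List.nodup_finRange k
  rw [h, List.nodup_append] at hn
  refine ⟨s, t, h, fun hs => hn.2.2 l hs l List.mem_cons_self rfl, ?_⟩
  exact (List.nodup_cons.1 hn.2.1).1

theorem run_flatMap_of_fixed {prog : Fin k → List (Round k A M)} {s : List (Fin k)}
    {ψ : (Fin k → A) × M × Unit → ℂ} (h : ∀ i ∈ s, run (prog i) ψ = ψ) :
    run (s.flatMap prog) ψ = ψ := by
  induction s with
  | nil => rfl
  | cons a s ih =>
    rw [List.flatMap_cons, run_append, h a List.mem_cons_self]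
    exact ih fun i hi => h i (List.mem_cons_of_mem _ hi)

/-- A sweep in which only party `l` acts non-trivially. -/
theorem run_sweep_eq {prog : Fin k → List (Round k A M)} (l : Fin k)
    {ψ χ : (Fin k → A) × M × Unit → ℂ} (hl : run (prog l) ψ = χ)
    (hψ : ∀ i, i ≠ l → run (prog i) ψ = ψ) (hχ : ∀ i, i ≠ l → run (prog i) χ = χ) :
    run (sweep prog) ψ = χ := by
  obtain ⟨s, t, h, hs, ht⟩ := exists_finRange_eq l
  rw [sweep, h, List.flatMap_append, List.flatMap_cons, run_append, run_append,
    run_flatMap_of_fixed fun i hi => hψ i fun e => hs (e ▸ hi), hl]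
  exact run_flatMap_of_fixed fun i hi => hχ i fun e => ht (e ▸ hi)

theorem Safe.sweep {prog : Fin k → List (Round k A M)} (hp : ∀ l, ∀ r ∈ prog l, r.party = l)
    {i : Fin k} {w w' : A → ℝ≥0∞} (h : Safe i (prog i) w w') : Safe i (sweep prog) w w' := by
  obtain ⟨s, t, e, hs, ht⟩ := exists_finRange_eq i
  have hne : ∀ s : List (Fin k), i ∉ s → ∀ r ∈ s.flatMap prog, r.party ≠ i := by
    intro s hs r hr hri
    obtain ⟨l, hl, hrl⟩ := List.mem_flatMap.1 hr
    rw [hp l r hrl] at hri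
    exact hs (hri ▸ hl)
  rw [QuantumCoin.sweep, e, List.flatMap_append, List.flatMap_cons]
  exact (Safe.of_ne (hne s hs) w).append (h.append (Safe.of_ne (hne t ht) w'))

/-- A sweep of permutations that do not change the message. -/
theorem run_sweep_perm_ket (f : Equiv.Perm (A × M)) (σ : Fin k → A) (m : M)
    (h : ∀ a, (f (a, m)).2 = m) :
    run (sweep fun i => [permRound i f]) (ket σ m) = ket (fun i => (f (σ i, m)).1) m := by
  have key : ∀ s : List (Fin k), s.Nodup → ∀ σ : Fin k → A,
      run (s.flatMap fun i => [permRound i f]) (ket σ m) =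
        ket (fun i => if i ∈ s then (f (σ i, m)).1 else σ i) m := by
    intro s
    induction s with
    | nil => intro _ σ; simp [run_nil]
    | cons a s ih =>
      intro hs σ
      rw [List.nodup_cons] at hs
      rw [List.flatMap_cons, run_append, run_perm_ket, h, ih hs.2]
      congr 1
      funext i
      by_cases hi : i = a
      · subst hi
        simp [hs.1]
      · simp [hi]
  rw [sweep, key _ (List.nodup_finRange k)]
  simp

end

/-! ### The protocol -/

/-- The basis of the message register. -/
inductive Msg
  | blank
  | bit (b : Bool)
  | lose
  | win
  deriving DecidableEq, Fintype

/-- The basis of the private register of each of the `n + 1` parties.  Game `j` decides whether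
party `j.succ`, the challenger, takes the crown from the present king.

* `wait`: the party has not yet been challenger;
* `heard b`: the challenger has received the bit `b` from the king;
* `kept`, `won`: the challenger, having heard `true`, resigns or claims the crown;
* `returned b`: the challenger has resigned and received the king's bit `b`;
* `crown m`: the party is king after the games before game `m`;
* `prepared j b`: the king has the bit `b` in game `j`;
* `out j`: the party has lost game `j`;
* `coin b`: the last king has tossed `b`;
* `copied j b`: a party that has lost game `j` has been told the outcome `b`.

A party that observes a deviation stays behind in a state that no later round of the protocol
affects; this is its way to abort. -/
inductive Priv (n : ℕ)
  | wait
  | heard (b : Bool)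
  | kept
  | won
  | returned (b : Bool)
  | crown (m : Fin (n + 1))
  | prepared (j : Fin n) (b : Bool)
  | out (j : Fin n)
  | coin (b : Bool)
  | copied (j : Fin n) (b : Bool)
  deriving DecidableEq, Fintype

open Priv Msg

/-- The outcome that a party reads off its private register. -/
def Priv.val {n : ℕ} : Priv n → Option Bool
  | coin b => some b
  | copied _ b => some b
  | _ => none

/-- The probability with which the challenger wins game `j`. -/
noncomputable def winProb {n : ℕ} (j : Fin n) : ℝ := 1 / ((j : ℝ) + 2)

/-- The amount by which the king's probability of preparing `true` exceeds `winProb`.  It lets the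
challenger resign in a superposition of the king's two bits, and so test the king's honesty. -/
noncomputable def excess (n : ℕ) : ℝ := 1 / (4 * ((n : ℝ) + 1))

section parameters

variable {n : ℕ} (j : Fin n)

theorem winProb_pos : 0 < winProb j := by unfold winProb; positivity

theorem winProb_le : winProb j ≤ 1 / 2 := by
  unfold winProb
  gcongr
  linarith [show (0 : ℝ) ≤ j from Nat.cast_nonneg _]

theorem excess_pos (n : ℕ) : 0 < excess n := by unfold excess; positivity

theorem excess_le (n : ℕ) : excess n ≤ 1 / 4 := by
  unfold excess
  gcongr
  linarith [show (0 : ℝ) ≤ n from Nat.cast_nonneg _]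

theorem prep_sq : √(1 - (winProb j + excess n)) ^ 2 + √(winProb j + excess n) ^ 2 = 1 := by
  have h1 := winProb_pos j
  have h2 := winProb_le j
  have h3 := excess_pos n
  have h4 := excess_le n
  rw [Real.sq_sqrt (by linarith), Real.sq_sqrt (by linarith)]
  ring

theorem claim_sq : √(excess n / (winProb j + excess n)) ^ 2 +
    √(winProb j / (winProb j + excess n)) ^ 2 = 1 := by
  have h1 := winProb_pos j
  have h3 := excess_pos n
  rw [Real.sq_sqrt (by positivity), Real.sq_sqrt (by positivity)]
  field_simp
  ring

theorem test_sq : √((1 - (winProb j + excess n)) / (1 - winProb j)) ^ 2 +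
    √(excess n / (1 - winProb j)) ^ 2 = 1 := by
  have h1 := winProb_pos j
  have h2 := winProb_le j
  have h3 := excess_pos n
  have h4 := excess_le n
  have h5 : 0 < 1 - winProb j := by linarith
  rw [Real.sq_sqrt (div_nonneg (by linarith) h5.le), Real.sq_sqrt (by positivity)]
  field_simp
  ring

theorem toss_sq : √(1 / 2 : ℝ) ^ 2 + √(1 / 2) ^ 2 = 1 := by
  rw [Real.sq_sqrt (by norm_num)]
  norm_num

end parameters

section rounds

variable {n : ℕ} (j : Fin n)

/-- The king prepares a superposition of the two bits and sends a copy of its bit. -/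
noncomputable def prepare (l : Fin (n + 1)) : List (Round (n + 1) (Priv n) Msg) :=
  [reflRound l (crown j.castSucc) (prepared j false) (prepared j true)
      √(1 - (winProb j + excess n)) √(winProb j + excess n) (by simp) (by simp) (by simp)
      (prep_sq j),
    permRound l (Equiv.swap (prepared j false, blank) (prepared j false, bit false) *
      Equiv.swap (prepared j true, blank) (prepared j true, bit true))]

/-- The challenger receives the bit.  It resigns if the bit is `false`; if it is `true`, it decides
in superposition whether to resign or to claim the crown. -/
noncomputable def claim : List (Round (n + 1) (Priv n) Msg) :=
  [permRound j.succ (Equiv.swap (wait, bit false) (heard false, lose) *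
      Equiv.swap (wait, bit true) (heard true, lose)),
    reflRound j.succ (heard true) kept won √(excess n / (winProb j + excess n))
      √(winProb j / (winProb j + excess n)) (by simp) (by simp) (by simp) (claim_sq j),
    permRound j.succ (Equiv.swap (won, lose) (won, win))]

/-- The king sends its bit to a challenger that resigns, and cedes the crown to a challenger that
claims it, provided that its bit is `true`. -/
noncomputable def respond (l : Fin (n + 1)) : List (Round (n + 1) (Priv n) Msg) :=
  [permRound l (Equiv.swap (prepared j false, lose) (crown j.succ, bit false) *
    Equiv.swap (prepared j true, lose) (crown j.succ, bit true) *
    Equiv.swap (prepared j true, win) (out j, blank))]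

/-- The challenger takes the crown, or tests that the two bits it holds after resigning are in the
superposition in which they should be. -/
noncomputable def verify : List (Round (n + 1) (Priv n) Msg) :=
  [permRound j.succ (Equiv.swap (heard false, bit false) (returned false, blank) *
      Equiv.swap (kept, bit true) (returned true, blank) *
      Equiv.swap (won, blank) (crown j.succ, blank)),
    reflRound j.succ (out j) (returned false) (returned true)
      √((1 - (winProb j + excess n)) / (1 - winProb j)) √(excess n / (1 - winProb j))
      (by simp) (by simp) (by simp) (test_sq j)]

/-- Game `j`, between the present king and party `j.succ`. -/
noncomputable def game : List (Round (n + 1) (Priv n) Msg) :=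
  sweep (prepare j) ++ (claim j ++ (sweep (respond j) ++ verify j))

/-- The first `m` games. -/
noncomputable def games : ∀ m ≤ n, List (Round (n + 1) (Priv n) Msg)
  | 0, _ => []
  | m + 1, h => games m (Nat.le_of_succ_le h) ++ game ⟨m, h⟩

/-- The last king tosses a coin and sends a copy of the outcome. -/
noncomputable def toss (n : ℕ) (l : Fin (n + 1)) : List (Round (n + 1) (Priv n) Msg) :=
  [reflRound l (crown (Fin.last n)) (coin false) (coin true) √(1 / 2) √(1 / 2)
      (by simp) (by simp) (by simp) toss_sq,
    permRound l (Equiv.swap (coin false, blank) (coin false, bit false) *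
      Equiv.swap (coin true, blank) (coin true, bit true))]

/-- A party that is not king copies the bit in the message register. -/
def copyFun (n : ℕ) : Priv n × Msg → Priv n × Msg
  | (out j, bit b) => (copied j b, bit b)
  | (copied j b, bit b') => if b = b' then (out j, bit b) else (copied j b, bit b')
  | y => y

theorem copyFun_involutive (n : ℕ) : Function.Involutive (copyFun n) := by
  rintro ⟨a, m⟩
  cases a <;> cases m <;> simp [copyFun]
  split_ifs with h <;> simp [h]

/-- The copying of the bit in the message register, as a permutation. -/
def copyPerm (n : ℕ) : Equiv.Perm (Priv n × Msg) := (copyFun_involutive n).toPerm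

/-- The rounds of the whole protocol. -/
noncomputable def allRounds (n : ℕ) : List (Round (n + 1) (Priv n) Msg) :=
  games n le_rfl ++ (sweep (toss n) ++ sweep fun i => [permRound i (copyPerm n)])

/-- Party `0` is the first king. -/
def initPriv (n : ℕ) (i : Fin (n + 1)) : Priv n := if i = 0 then crown 0 else wait

/-- The coin-flipping protocol for `n + 1` parties. -/
noncomputable def coinProtocol (n : ℕ) : Protocol (n + 1) :=
  ofRounds (allRounds n) (initPriv n) blank Priv.val

end rounds

/-! ### Security -/

section security

variable {n : ℕ}

/-- A lower bound on the probability that a party that is king after the games before game `m`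
makes the coalition fail: either it is last king and tosses the other bit, or it aborts. -/
noncomputable def kingValue (n m : ℕ) : ℝ :=
  ((m : ℝ) + 1) / (4 * ((n : ℝ) + 1)) * (1 + ((m : ℝ) + 1) / ((n : ℝ) + 1))

/-- The bound on the success probability of the coalition against a party that waits. -/
noncomputable def waitBound (n : ℕ) : ℝ := 1 - 1 / (12 * ((n : ℝ) + 1))

/-- The weights for a party that has not yet been challenger. -/
noncomputable def waitWeight (n : ℕ) : Priv n → ℝ≥0∞
  | wait => ENNReal.ofReal (waitBound n)
  | _ => ⊤

/-- The weights before game `m` for a party that has been challenger before. -/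
noncomputable def playWeight (n m : ℕ) : Priv n → ℝ≥0∞
  | crown c => if (c : ℕ) < m then 0 else
      if (c : ℕ) = m then ENNReal.ofReal (1 - kingValue n m) else ⊤
  | out c => if (c : ℕ) < m then 1 else ⊤
  | prepared c _ => if (c : ℕ) < m then 0 else ⊤
  | coin _ => ⊤
  | copied _ _ => ⊤
  | _ => 0

/-- The weights in game `j` for a party other than the challenger, after the king's preparation. -/
noncomputable def prepWeight (j : Fin n) : Priv n → ℝ≥0∞
  | crown c => if (c : ℕ) ≤ j then 0 else ⊤
  | out c => if (c : ℕ) < j then 1 else ⊤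
  | prepared c b => if (c : ℕ) < j then 0 else if c = j then
      (if b then 1 else ENNReal.ofReal (1 - kingValue n (j + 1))) else ⊤
  | coin _ => ⊤
  | copied _ _ => ⊤
  | _ => 0

/-- The weights for the challenger when it has heard the king's bit. -/
noncomputable def heardWeight (n : ℕ) : Priv n → ℝ≥0∞
  | wait => ENNReal.ofReal (waitBound n)
  | heard _ => ENNReal.ofReal (waitBound n)
  | _ => ⊤

/-- The weights for the challenger of game `j` after its claim.  The weight on `kept` exceeds `1`,
as only then the weight on `heard false` can be less than `1`. -/
noncomputable def claimWeight (j : Fin n) : Priv n → ℝ≥0∞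
  | wait => ENNReal.ofReal (waitBound n)
  | heard _ => ENNReal.ofReal (waitBound n)
  | kept => ENNReal.ofReal (3 / 2)
  | won => ENNReal.ofReal (1 - kingValue n (j + 1))
  | _ => ⊤

/-- The weights for the challenger of game `j` before its test. -/
noncomputable def returnedWeight (j : Fin n) : Priv n → ℝ≥0∞
  | wait => 0
  | heard _ => 0
  | kept => 0
  | won => 0
  | returned b => if b then ENNReal.ofReal (3 / 2) else ENNReal.ofReal (waitBound n)
  | crown c => if c = j.succ then ENNReal.ofReal (1 - kingValue n (j + 1)) else ⊤
  | _ => ⊤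

/-- The weights of party `i` before game `m`. -/
noncomputable def statusWeight (i : Fin (n + 1)) (m : ℕ) : Priv n → ℝ≥0∞ :=
  if (i : ℕ) ≤ m then playWeight n m else waitWeight n

theorem party_prepare (j : Fin n) : ∀ l, ∀ r ∈ prepare j l, r.party = l := by
  intro l r hr
  simp only [prepare, List.mem_cons, List.not_mem_nil, or_false] at hr
  rcases hr with rfl | rfl <;> rfl

theorem party_claim (j : Fin n) : ∀ r ∈ claim j, r.party = j.succ := by
  intro r hr
  simp only [claim, List.mem_cons, List.not_mem_nil, or_false] at hr
  rcases hr with rfl | rfl | rfl <;> rfl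

theorem party_respond (j : Fin n) : ∀ l, ∀ r ∈ respond j l, r.party = l := by
  intro l r hr
  simp only [respond, List.mem_cons, List.not_mem_nil, or_false] at hr
  subst hr
  rfl

theorem party_verify (j : Fin n) : ∀ r ∈ verify j, r.party = j.succ := by
  intro r hr
  simp only [verify, List.mem_cons, List.not_mem_nil, or_false] at hr
  rcases hr with rfl | rfl <;> rfl

theorem party_toss (n : ℕ) : ∀ l, ∀ r ∈ toss n l, r.party = l := by
  intro l r hr
  simp only [toss, List.mem_cons, List.not_mem_nil, or_false] at hr
  rcases hr with rfl | rfl <;> rfl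

theorem kingValue_nonneg (n m : ℕ) : 0 ≤ kingValue n m := by unfold kingValue; positivity

theorem kingValue_le {n m : ℕ} (h : m ≤ n) : kingValue n m ≤ 1 / 2 := by
  have hm : (m : ℝ) ≤ n := by exact_mod_cast h
  have h1 : ((m : ℝ) + 1) / (4 * ((n : ℝ) + 1)) ≤ 1 / 4 := by
    rw [div_le_div_iff₀ (by positivity) (by positivity)]
    linarith
  have h2 : ((m : ℝ) + 1) / ((n : ℝ) + 1) ≤ 1 := by
    rw [div_le_one (by positivity)]
    linarith
  calc kingValue n m ≤ 1 / 4 * (1 + 1) := by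
        unfold kingValue
        gcongr
    _ = 1 / 2 := by norm_num

theorem kingValue_self (n : ℕ) : kingValue n n = 1 / 2 := by
  unfold kingValue
  field_simp
  norm_num

/-- The crown's value is preserved by an honest king's game. -/
theorem kingValue_le_succ (j : Fin n) :
    kingValue n j ≤ (1 - (winProb j + excess n)) * kingValue n (j + 1) := by
  have hj : ((j : ℕ) : ℝ) + 1 ≤ n := by exact_mod_cast j.2
  have h0 : (0 : ℝ) ≤ (j : ℕ) := Nat.cast_nonneg _
  unfold kingValue winProb excess
  rw [← sub_nonneg]
  push_cast
  generalize ((j : ℕ) : ℝ) = a at *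
  generalize (n : ℝ) = b at *
  have hb : 0 < b + 1 := by linarith
  have : (1 - (1 / (a + 2) + 1 / (4 * (b + 1)))) *
      ((a + 1 + 1) / (4 * (b + 1)) * (1 + (a + 1 + 1) / (b + 1))) -
      (a + 1) / (4 * (b + 1)) * (1 + (a + 1) / (b + 1)) =
      (4 * (b + 1) * (a + 1) - (a + 2) * (a + b + 3)) / (16 * (b + 1) ^ 3) := by
    field_simp
    ring
  rw [this]
  refine div_nonneg ?_ (by positivity)
  nlinarith

theorem waitBound_pos (n : ℕ) : 0 < waitBound n := by
  have : 1 / (12 * ((n : ℝ) + 1)) ≤ 1 / 12 := by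
    gcongr
    linarith [show (0 : ℝ) ≤ n from Nat.cast_nonneg _]
  unfold waitBound
  linarith

/-- What the coalition gains on `kept` is outweighed by the crown that it loses on `won`. -/
theorem claim_bound (j : Fin n) : 3 / 2 * (excess n / (winProb j + excess n)) +
    (1 - kingValue n (j + 1)) * (winProb j / (winProb j + excess n)) ≤ waitBound n := by
  have h1 := winProb_pos j
  have h2 := winProb_le j
  have h3 := excess_pos n
  have h4 := excess_le n
  have hv : excess n ≤ winProb j * kingValue n (j + 1) := by
    have : winProb j * kingValue n (j + 1) =
        excess n * (1 + ((j : ℕ) + 2) / ((n : ℝ) + 1)) := by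
      unfold winProb kingValue excess
      push_cast
      field_simp
      ring
    rw [this]
    exact le_mul_of_one_le_right h3.le (by simp; positivity)
  have hz : waitBound n = 1 - excess n / 3 := by
    unfold waitBound excess
    field_simp
    ring
  rw [hz, ← mul_div_assoc, ← mul_div_assoc, ← add_div, div_le_iff₀ (by linarith)]
  nlinarith

/-- The test detects a king that sends `false` always. -/
theorem test_bound (j : Fin n) : (1 - (winProb j + excess n)) / (1 - winProb j) / waitBound n +
    excess n / (1 - winProb j) / (3 / 2) ≤ 1 := by
  have h1 := winProb_pos j
  have h2 := winProb_le j
  have h3 := excess_pos n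
  have h4 := excess_le n
  have hz : waitBound n = 1 - excess n / 3 := by
    unfold waitBound excess
    field_simp
    ring
  have hz0 : 0 < waitBound n := waitBound_pos n
  have hp : 0 < 1 - winProb j := by linarith
  rw [div_div, div_div, div_add_div _ _ (by positivity) (by positivity),
    div_le_one (by positivity), hz]
  have : 0 ≤ (1 - winProb j) * (winProb j * excess n) * (1 / 2) := by positivity
  nlinarith [mul_pos hp h3, mul_pos (mul_pos hp h3) h3]

theorem ofReal_split {u v r s t : ℝ} (hu : 0 ≤ u) (hv : 0 ≤ v) (hr : 0 ≤ r) (hs : 0 ≤ s)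
    (h : u * r + v * s ≤ t) :
    ENNReal.ofReal u * ENNReal.ofReal (√r ^ 2) + ENNReal.ofReal v * ENNReal.ofReal (√s ^ 2) ≤
      ENNReal.ofReal t := by
  rw [Real.sq_sqrt hr, Real.sq_sqrt hs, ← ENNReal.ofReal_mul hu, ← ENNReal.ofReal_mul hv,
    ← ENNReal.ofReal_add (by positivity) (by positivity)]
  exact ENNReal.ofReal_le_ofReal h

theorem safe_prepare_play (i : Fin (n + 1)) (j : Fin n) :
    Safe i (prepare j i) (playWeight n j) (prepWeight j) := by
  have h1 := winProb_pos j
  have h2 := winProb_le j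
  have h3 := excess_pos n
  have h4 := excess_le n
  refine Safe.append (L := [_]) (L' := [_]) (v := prepWeight j)
    (Safe.refl_of_le i _ _ _ _ (wnorm_refl_le_of_split (by simp) (by simp) (by simp) ?_ ?_ ?_ ?_))
    (Safe.perm i _ ?_)
  · intro a ha0 ha1 ha2
    cases a with
    | crown c =>
      have hc : c ≠ j.castSucc := fun e => ha0 (e ▸ rfl)
      have hc' : (c : ℕ) ≠ j := fun e => hc (Fin.ext e)
      simp only [prepWeight, playWeight]
      split_ifs <;> first | omega | simp
    | prepared c b =>
      have hc : c ≠ j := by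
        rintro rfl
        cases b <;> simp at ha1 ha2
      simp [prepWeight, playWeight, hc]
    | _ => simp [prepWeight, playWeight]
  · simp [playWeight]
  · simp [playWeight]
  · simp only [prepWeight, playWeight, lt_irrefl, if_false, if_true, Fin.val_castSucc,
      Bool.false_eq_true, ← ENNReal.ofReal_one]
    refine ofReal_split ?_ zero_le_one (by linarith) (by linarith) ?_
    · linarith [kingValue_le (n := n) (m := j + 1) j.2]
    · linarith [kingValue_le_succ j]
  · intro a m
    rcases a with _ | _ | _ | _ | _ | c | ⟨c, _ | _⟩ | c | _ | _ <;>
      rcases m with _ | (_ | _) | _ | _ <;> simp [Equiv.swap_apply_def] <;> split_ifs <;> simp_all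

theorem safe_respond_play (i : Fin (n + 1)) (j : Fin n) :
    Safe i (respond j i) (prepWeight j) (playWeight n (j + 1)) := by
  have hle : ENNReal.ofReal (1 - kingValue n (j + 1)) ≤ 1 :=
    ENNReal.ofReal_le_one.2 (by linarith [kingValue_nonneg n (j + 1)])
  have hmono : ∀ a, playWeight n (j + 1) a ≤ prepWeight j a := by
    intro a
    cases a with
    | crown c =>
      simp only [playWeight, prepWeight]
      split_ifs <;> first | omega | simp
    | out c =>
      simp only [playWeight, prepWeight]
      split_ifs <;> first | omega | simp
    | prepared c b =>
      have hc : c = j ↔ (c : ℕ) = j := Fin.ext_iff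
      simp only [playWeight, prepWeight, hc]
      split_ifs <;> first | omega | simp
    | _ => simp [playWeight, prepWeight]
  refine Safe.perm i _ fun a m => ?_
  cases a with
  | crown c =>
    by_cases hc : c = j.succ
    · simp [hc, prepWeight]
    · rcases m with _ | (_ | _) | _ | _ <;> simp [Equiv.swap_apply_def, hc, hmono]
  | prepared c b =>
    by_cases hc : c = j
    · subst hc
      rcases b with _ | _ <;> rcases m with _ | (_ | _) | _ | _ <;>
        simp [Equiv.swap_apply_def, playWeight, prepWeight, hle]
    · simp [Equiv.swap_apply_def, hc, hmono]
  | out c =>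
    by_cases hc : c = j
    · simp [hc, prepWeight]
    · simp [Equiv.swap_apply_def, hc, hmono]
  | _ => simp [Equiv.swap_apply_def, hmono]

theorem safe_game_play (i : Fin (n + 1)) (j : Fin n) (hi : i ≠ j.succ) :
    Safe i (game j) (playWeight n j) (playWeight n (j + 1)) :=
  (Safe.sweep (party_prepare j) (safe_prepare_play i j)).append <|
    (Safe.of_ne (fun r hr => (party_claim j r hr).trans_ne hi.symm) _).append <|
      (Safe.sweep (party_respond j) (safe_respond_play i j)).append <|
        Safe.of_ne (fun r hr => (party_verify j r hr).trans_ne hi.symm) _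

theorem safe_prepare_wait (i : Fin (n + 1)) (j : Fin n) :
    Safe i (prepare j i) (waitWeight n) (waitWeight n) := by
  refine Safe.append (L := [_]) (L' := [_]) (v := waitWeight n)
    (Safe.refl_of_le i _ _ _ _ (wnorm_refl_le_of_split (by simp) (by simp) (by simp) ?_ ?_ ?_ ?_))
    (Safe.perm i _ ?_)
  · intro a _ _ _
    exact le_rfl
  · simp [waitWeight]
  · simp [waitWeight]
  · simp [waitWeight]
  · intro a m
    cases a <;> simp [waitWeight, Equiv.swap_apply_def]

theorem safe_respond_wait (i : Fin (n + 1)) (j : Fin n) :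
    Safe i (respond j i) (waitWeight n) (waitWeight n) := by
  refine Safe.perm i _ fun a m => ?_
  cases a <;> simp [waitWeight, Equiv.swap_apply_def]

theorem safe_game_wait (i : Fin (n + 1)) (j : Fin n) (hi : i ≠ j.succ) :
    Safe i (game j) (waitWeight n) (waitWeight n) :=
  (Safe.sweep (party_prepare j) (safe_prepare_wait i j)).append <|
    (Safe.of_ne (fun r hr => (party_claim j r hr).trans_ne hi.symm) _).append <|
      (Safe.sweep (party_respond j) (safe_respond_wait i j)).append <|
        Safe.of_ne (fun r hr => (party_verify j r hr).trans_ne hi.symm) _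

theorem safe_claim (j : Fin n) :
    Safe j.succ (claim j) (waitWeight n) (claimWeight j) := by
  have h1 := winProb_pos j
  have h3 := excess_pos n
  refine Safe.append (L := [_]) (L' := [_, _]) (v := heardWeight n) (Safe.perm _ _ ?_)
    (Safe.append (L := [_]) (L' := [_]) (v := claimWeight j)
      (Safe.refl_of_le _ _ _ _ _
        (wnorm_refl_le_of_split (by simp) (by simp) (by simp) ?_ ?_ ?_ ?_))
      (Safe.perm _ _ ?_))
  · intro a m
    rcases a with _ | (_ | _) | _ | _ | _ | _ | _ | _ | _ | _ <;>
      rcases m with _ | (_ | _) | _ | _ <;>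
      simp [Equiv.swap_apply_def, waitWeight, heardWeight]
  · intro a ha0 ha1 ha2
    cases a <;> simp_all [heardWeight, claimWeight]
  · simp [heardWeight]
  · simp [heardWeight]
  · simp only [heardWeight, claimWeight]
    refine ofReal_split (by norm_num) ?_ (by positivity) (by positivity) (claim_bound j)
    linarith [kingValue_le (n := n) (m := j + 1) j.2]
  · intro a m
    cases a <;> rcases m with _ | (_ | _) | _ | _ <;> simp [Equiv.swap_apply_def, claimWeight]

theorem safe_respond_claim (j : Fin n) :
    Safe j.succ (respond j j.succ) (claimWeight j) (claimWeight j) := by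
  refine Safe.perm _ _ fun a m => ?_
  cases a <;> simp [claimWeight, Equiv.swap_apply_def]

theorem safe_verify (j : Fin n) :
    Safe j.succ (verify j) (claimWeight j) (playWeight n (j + 1)) := by
  have h1 := winProb_pos j
  have h2 := winProb_le j
  have h3 := excess_pos n
  have h4 := excess_le n
  refine Safe.append (L := [_]) (L' := [_]) (v := returnedWeight j) (Safe.perm _ _ ?_)
    (Safe.refl_of_le _ _ _ _ _ (wnorm_refl_le_of_merge (by simp) (by simp) (by simp) ?_ ?_ ?_
      (waitBound_pos n) (show (0 : ℝ) < 3 / 2 by norm_num) zero_le_one ?_ ?_ ?_ ?_))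
  · intro a m
    rcases a with _ | (_ | _) | _ | _ | _ | _ | _ | _ | _ | _ <;>
      rcases m with _ | (_ | _) | _ | _ <;>
      simp [Equiv.swap_apply_def, claimWeight, returnedWeight]
  · intro a ha0 ha1 ha2
    cases a with
    | crown c =>
      have hs : c = j.succ ↔ (c : ℕ) = j + 1 := by simp [Fin.ext_iff]
      simp only [returnedWeight, playWeight, hs]
      split_ifs <;> simp_all
    | _ => simp_all [returnedWeight, playWeight]
  · simp [playWeight]
  · simp [playWeight]
  · simp [returnedWeight]
  · simp [returnedWeight]
  · simp [playWeight]
  · rw [Real.sq_sqrt (div_nonneg (by linarith) (by linarith)),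
      Real.sq_sqrt (div_nonneg h3.le (by linarith)), one_mul]
    exact test_bound j

theorem safe_game (i : Fin (n + 1)) (j : Fin n) :
    Safe i (game j) (statusWeight i j) (statusWeight i (j + 1)) := by
  unfold statusWeight
  by_cases h : (i : ℕ) ≤ j
  · rw [if_pos h, if_pos (by omega)]
    refine safe_game_play i j ?_
    rintro rfl
    simp at h
  · rw [if_neg h]
    by_cases hj : i = j.succ
    · subst hj
      rw [if_pos (by simp)]
      exact (Safe.sweep (party_prepare j) (safe_prepare_wait _ j)).append <|
        (safe_claim j).append <|
          (Safe.sweep (party_respond j) (safe_respond_claim j)).append (safe_verify j)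
    · rw [if_neg]
      · exact safe_game_wait i j hj
      · intro h'
        exact hj (Fin.ext (by simp; omega))

theorem safe_games (i : Fin (n + 1)) : ∀ (m : ℕ) (hm : m ≤ n),
    Safe i (games m hm) (statusWeight i 0) (statusWeight i m)
  | 0, _ => fun _ => le_rfl
  | m + 1, hm => (safe_games i m (Nat.le_of_succ_le hm)).append (safe_game i ⟨m, hm⟩)

/-- The weights after the last king's toss, for the outcome `b`. -/
noncomputable def tossWeight (n : ℕ) (b : Bool) : Priv n → ℝ≥0∞
  | out _ => 1
  | coin b' => if b' = b then 1 else 0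
  | copied _ _ => ⊤
  | _ => 0

theorem safe_toss (i : Fin (n + 1)) (b : Bool) :
    Safe i (toss n i) (playWeight n n) (tossWeight n b) := by
  refine Safe.append (L := [_]) (L' := [_]) (v := tossWeight n b)
    (Safe.refl_of_le i _ _ _ _ (wnorm_refl_le_of_split (by simp) (by simp) (by simp) ?_ ?_ ?_ ?_))
    (Safe.perm i _ ?_)
  · intro a ha0 ha1 ha2
    cases a with
    | coin b => cases b <;> simp_all
    | out c => simp [tossWeight, playWeight]
    | _ => simp [tossWeight, playWeight]
  · simp [playWeight]
  · simp [playWeight]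
  · simp only [playWeight, Fin.val_last, lt_irrefl, if_false, if_true, kingValue_self, tossWeight]
    have h2 : (2⁻¹ : ℝ≥0∞) = ENNReal.ofReal (1 - 1 / 2) := by
      rw [show (1 - 1 / 2 : ℝ) = 2⁻¹ by norm_num, ENNReal.ofReal_inv_of_pos two_pos]
      simp
    rw [← h2]
    cases b <;> simp
  · intro a m
    rcases a with _ | _ | _ | _ | _ | _ | _ | _ | (_ | _) | _ <;>
      rcases m with _ | (_ | _) | _ | _ <;> simp [Equiv.swap_apply_def, tossWeight]

theorem safe_copy (i : Fin (n + 1)) (b : Bool) :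
    Safe i [permRound i (copyPerm n)] (tossWeight n b)
      (fun a => if a.val = some b then 1 else 0) := by
  refine Safe.perm i _ fun a m => ?_
  change (if (copyFun n (a, m)).1.val = some b then 1 else 0) ≤ _
  cases a <;> cases m <;> simp [copyFun, tossWeight, Priv.val]
  split_ifs <;> simp

theorem safe_allRounds (i : Fin (n + 1)) (b : Bool) :
    Safe i (allRounds n) (statusWeight i 0) (fun a => if a.val = some b then 1 else 0) := by
  refine (safe_games i n le_rfl).append ?_
  rw [statusWeight, if_pos (by omega)]
  refine (Safe.sweep (party_toss n) (safe_toss i b)).append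
    (Safe.sweep (prog := fun i => [permRound i (copyPerm n)]) ?_ (safe_copy i b))
  intro l r hr
  rw [List.mem_singleton] at hr
  subst hr
  rfl

theorem statusWeight_initPriv (i : Fin (n + 1)) :
    statusWeight i 0 (initPriv n i) ≤ ENNReal.ofReal (waitBound n) := by
  by_cases h : i = 0
  · subst h
    simp only [statusWeight, initPriv, Fin.val_zero, le_refl, if_true]
    refine ENNReal.ofReal_le_ofReal ?_
    have : 1 / (12 * ((n : ℝ) + 1)) ≤ 1 / (4 * ((n : ℝ) + 1)) := by gcongr; norm_num
    have h2 : 1 / (4 * ((n : ℝ) + 1)) ≤ kingValue n 0 := by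
      unfold kingValue
      simp only [Nat.cast_zero, zero_add]
      refine le_mul_of_one_le_right (by positivity) ?_
      simp
      positivity
    unfold waitBound
    linarith
  · have h' : ¬ (i : ℕ) ≤ 0 := fun e => h (Fin.ext (by simpa using e))
    rw [statusWeight, if_neg h', initPriv, if_neg h]
    exact le_rfl

theorem coinProtocol_outcomeProb_le {D : Finset (Fin (n + 1))} (S : (coinProtocol n).Strategy D)
    {i : Fin (n + 1)} (hi : i ∉ D) (b : Bool) :
    (coinProtocol n).outcomeProb ((coinProtocol n).cheatState S (coinProtocol n).N) i b ≤
      waitBound n := by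
  rw [← ENNReal.ofReal_le_ofReal_iff (waitBound_pos n).le]
  refine (outcomeProb_ofRounds ..).trans_le ?_
  exact (potential_cheatState_le _ _ _ _ S hi (safe_allRounds i b)).trans
    (statusWeight_initPriv i)

end security

/-! ### The honest run of a game -/

section honest

variable {n : ℕ}

/-- The private registers `σ`, with those of the parties `l` and `h` replaced by `a` and `b`. -/
def setTwo (σ : Fin (n + 1) → Priv n) (l h : Fin (n + 1)) (a b : Priv n) : Fin (n + 1) → Priv n :=
  Function.update (Function.update σ l a) h b

section setTwo

variable {σ : Fin (n + 1) → Priv n} {l h : Fin (n + 1)} (a b c : Priv n)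

theorem setTwo_left (hl : l ≠ h) : setTwo σ l h a b l = a := by simp [setTwo, hl]

theorem setTwo_right : setTwo σ l h a b h = b := by simp [setTwo]

theorem setTwo_of_ne {i : Fin (n + 1)} (hil : i ≠ l) (hih : i ≠ h) : setTwo σ l h a b i = σ i := by
  simp [setTwo, hil, hih]

theorem update_setTwo_left (hl : l ≠ h) :
    Function.update (setTwo σ l h a b) l c = setTwo σ l h c b := by
  rw [setTwo, Function.update_comm hl.symm, Function.update_idem, setTwo]

theorem update_setTwo_right :
    Function.update (setTwo σ l h a b) h c = setTwo σ l h a c := by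
  rw [setTwo, Function.update_idem, setTwo]

end setTwo

/-- The configuration `σ` occurs in an honest run after the games before game `m`, with king `l`. -/
structure IsConfig (m l : Fin (n + 1)) (σ : Fin (n + 1) → Priv n) : Prop where
  king_le : l ≤ m
  king : σ l = crown m
  out : ∀ i, i ≠ l → i ≤ m → ∃ j : Fin n, j.castSucc < m ∧ σ i = out j
  wait : ∀ i, m < i → σ i = wait

theorem run_perm_ket_of_fixed (i : Fin (n + 1)) (f : Equiv.Perm (Priv n × Msg))
    {σ : Fin (n + 1) → Priv n} {m : Msg} (h : f (σ i, m) = (σ i, m)) :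
    run [permRound i f] (ket σ m) = ket σ m := by
  rw [run_perm_ket, h, Function.update_eq_self]

theorem run_perm_setTwo_left {l h : Fin (n + 1)} (hl : l ≠ h) {f : Equiv.Perm (Priv n × Msg)}
    {σ : Fin (n + 1) → Priv n} {a a' b : Priv n} {m m' : Msg} (hf : f (a, m) = (a', m')) :
    run [permRound l f] (ket (setTwo σ l h a b) m) = ket (setTwo σ l h a' b) m' := by
  rw [run_perm_ket, setTwo_left _ _ hl, hf, update_setTwo_left _ _ _ hl]

theorem run_perm_setTwo_right {l h : Fin (n + 1)} {f : Equiv.Perm (Priv n × Msg)}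
    {σ : Fin (n + 1) → Priv n} {a b b' : Priv n} {m m' : Msg} (hf : f (b, m) = (b', m')) :
    run [permRound h f] (ket (setTwo σ l h a b) m) = ket (setTwo σ l h a b') m' := by
  rw [run_perm_ket, setTwo_right, hf, update_setTwo_right]

theorem run_prepare_of_ne (j : Fin n) {i : Fin (n + 1)} {σ : Fin (n + 1) → Priv n} (m : Msg)
    (h1 : σ i ≠ crown j.castSucc) (h2 : ∀ b, σ i ≠ prepared j b) :
    run (prepare j i) (ket σ m) = ket σ m := by
  rw [prepare, run_cons, run_refl_ket_of_ne _ _ _ _ _ _ h1 (h2 _) (h2 _)]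
  exact run_perm_ket_of_fixed _ _ (by simp [Equiv.swap_apply_def, h2])

theorem run_respond_of_ne (j : Fin n) {i : Fin (n + 1)} {σ : Fin (n + 1) → Priv n} (m : Msg)
    (h1 : σ i ≠ crown j.succ) (h2 : ∀ b, σ i ≠ prepared j b) (h3 : σ i ≠ out j) :
    run (respond j i) (ket σ m) = ket σ m :=
  run_perm_ket_of_fixed _ _ (by simp [Equiv.swap_apply_def, h1, h2, h3])

section game

variable {j : Fin n} {l : Fin (n + 1)} {σ : Fin (n + 1) → Priv n}

theorem IsConfig.king_ne (hσ : IsConfig j.castSucc l σ) : l ≠ j.succ :=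
  (hσ.king_le.trans_lt j.castSucc_lt_succ).ne

theorem IsConfig.setTwo_eq (hσ : IsConfig j.castSucc l σ) :
    setTwo σ l j.succ (crown j.castSucc) Priv.wait = σ := by
  rw [setTwo, ← hσ.king, Function.update_eq_self, ← hσ.wait _ j.castSucc_lt_succ,
    Function.update_eq_self]

theorem IsConfig.bystander (hσ : IsConfig j.castSucc l σ) {i : Fin (n + 1)} (hil : i ≠ l) :
    σ i = Priv.wait ∨ ∃ c, c ≠ j ∧ σ i = Priv.out c := by
  rcases le_or_gt i j.castSucc with h | h
  · obtain ⟨c, hc, e⟩ := hσ.out i hil h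
    exact Or.inr ⟨c, (Fin.castSucc_lt_castSucc_iff.1 hc).ne, e⟩
  · exact Or.inl (hσ.wait i h)

theorem run_sweep_prepare (hσ : IsConfig j.castSucc l σ) :
    run (sweep (prepare j)) (ket σ blank) =
      (√(1 - (winProb j + excess n)) : ℂ) •
          ket (setTwo σ l j.succ (prepared j false) Priv.wait) (bit false) +
        (√(winProb j + excess n) : ℂ) •
          ket (setTwo σ l j.succ (prepared j true) Priv.wait) (bit true) := by
  have hl := hσ.king_ne
  have idle : ∀ a m i, i ≠ l → run (prepare j i) (ket (setTwo σ l j.succ a Priv.wait) m) =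
      ket (setTwo σ l j.succ a Priv.wait) m := by
    intro a m i hil
    have hi : setTwo σ l j.succ a Priv.wait i = Priv.wait ∨
        ∃ c, c ≠ j ∧ setTwo σ l j.succ a Priv.wait i = Priv.out c := by
      by_cases hih : i = j.succ
      · subst hih
        exact Or.inl (setTwo_right ..)
      · rw [setTwo_of_ne _ _ hil hih]
        exact hσ.bystander hil
    refine run_prepare_of_ne j m ?_ fun b => ?_
    all_goals rcases hi with hi | ⟨c, _, hi⟩ <;> simp [hi]
  rw [← congrArg (fun τ => ket τ blank) hσ.setTwo_eq]
  refine run_sweep_eq l ?_ (fun i hi => idle _ _ i hi) fun i hi => ?_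
  · rw [prepare, run_cons, run_refl_ket_split _ _ _ _ _ _ (setTwo_left _ _ hl),
      update_setTwo_left _ _ _ hl, update_setTwo_left _ _ _ hl, run_add, run_smul, run_smul,
      run_perm_setTwo_left (a' := prepared j false) (m' := bit false) hl,
      run_perm_setTwo_left (a' := prepared j true) (m' := bit true) hl]
    all_goals simp [Equiv.swap_apply_def]
  · rw [run_add, run_smul, run_smul, idle _ _ i hi, idle _ _ i hi]

theorem run_claim_false (a : Priv n) :
    run (claim j) (ket (setTwo σ l j.succ a Priv.wait) (bit false)) =
      ket (setTwo σ l j.succ a (heard false)) lose := by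
  rw [claim, run_cons, run_perm_setTwo_right (b' := heard false) (m' := lose), run_cons,
    run_refl_ket_of_ne, run_perm_ket_of_fixed]
  all_goals simp [Equiv.swap_apply_def, setTwo_right]

theorem run_claim_true (a : Priv n) :
    run (claim j) (ket (setTwo σ l j.succ a Priv.wait) (bit true)) =
      (√(excess n / (winProb j + excess n)) : ℂ) • ket (setTwo σ l j.succ a kept) lose +
        (√(winProb j / (winProb j + excess n)) : ℂ) • ket (setTwo σ l j.succ a won) win := by
  rw [claim, run_cons, run_perm_setTwo_right (b' := heard true) (m' := lose), run_cons,
    run_refl_ket_split _ _ _ _ _ _ (setTwo_right ..), update_setTwo_right, update_setTwo_right,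
    run_add, run_smul, run_smul, run_perm_ket_of_fixed,
    run_perm_setTwo_right (b' := won) (m' := win)]
  all_goals simp [Equiv.swap_apply_def, setTwo_right]

theorem run_sweep_respond (hσ : IsConfig j.castSucc l σ) {a a' b : Priv n} {m m' : Msg}
    (hf : (Equiv.swap (prepared j false, lose) (crown j.succ, bit false) *
      Equiv.swap (prepared j true, lose) (crown j.succ, bit true) *
      Equiv.swap (prepared j true, win) (Priv.out j, blank)) (a, m) = (a', m'))
    (h1 : b ≠ crown j.succ) (h2 : ∀ c, b ≠ prepared j c) (h3 : b ≠ Priv.out j) :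
    run (sweep (respond j)) (ket (setTwo σ l j.succ a b) m) =
      ket (setTwo σ l j.succ a' b) m' := by
  have hl := hσ.king_ne
  have idle : ∀ a m i, i ≠ l → run (respond j i) (ket (setTwo σ l j.succ a b) m) =
      ket (setTwo σ l j.succ a b) m := by
    intro a m i hil
    by_cases hih : i = j.succ
    · subst hih
      refine run_respond_of_ne j m ?_ (fun c => ?_) ?_
      all_goals rw [setTwo_right]
      exacts [h1, h2 c, h3]
    · refine run_respond_of_ne j m ?_ (fun c => ?_) ?_
      all_goals rw [setTwo_of_ne _ _ hil hih]
      all_goals rcases hσ.bystander hil with hi | ⟨c, hc, hi⟩ <;> simp [hi]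
      exact hc
  refine run_sweep_eq l ?_ (fun i hi => idle _ _ i hi) fun i hi => idle _ _ i hi
  exact run_perm_setTwo_left hl hf

theorem run_verify_lose (a : Priv n) :
    run (verify j)
      ((√((1 - (winProb j + excess n)) / (1 - winProb j)) : ℂ) •
          ket (setTwo σ l j.succ a (heard false)) (bit false) +
        (√(excess n / (1 - winProb j)) : ℂ) • ket (setTwo σ l j.succ a kept) (bit true)) =
      ket (setTwo σ l j.succ a (Priv.out j)) blank := by
  rw [verify, run_cons, run_add, run_smul, run_smul,
    run_perm_setTwo_right (b' := returned false) (m' := blank),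
    run_perm_setTwo_right (b' := returned true) (m' := blank),
    ← update_setTwo_right a (Priv.out j) (returned false),
    ← update_setTwo_right a (Priv.out j) (returned true), run_refl_ket_merge,
    update_setTwo_right]
  all_goals simp [Equiv.swap_apply_def]

theorem run_verify_win (a : Priv n) :
    run (verify j) (ket (setTwo σ l j.succ a won) blank) =
      ket (setTwo σ l j.succ a (crown j.succ)) blank := by
  rw [verify, run_cons, run_perm_setTwo_right (b' := crown j.succ) (m' := blank),
    run_refl_ket_of_ne]
  all_goals simp [Equiv.swap_apply_def, setTwo_right]

/-- In an honest run the challenger wins game `j` with probability `winProb j`, and else its test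
succeeds with certainty. -/
theorem run_game (hσ : IsConfig j.castSucc l σ) :
    run (game j) (ket σ blank) =
      (√(1 - winProb j) : ℂ) •
          ket (setTwo σ l j.succ (crown j.succ) (Priv.out j)) blank +
        (√(winProb j) : ℂ) • ket (setTwo σ l j.succ (Priv.out j) (crown j.succ)) blank := by
  have h1 := winProb_pos j
  have h2 := winProb_le j
  have h3 := excess_pos n
  have h4 := excess_le n
  have mul_sqrt : ∀ x y z : ℝ, 0 ≤ x → x * y = z → (√x : ℂ) * √y = √z := by
    intro x y z hx h
    rw [← h, Real.sqrt_mul hx]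
    push_cast
    rfl
  have e1 : (√(1 - winProb j) : ℂ) * √((1 - (winProb j + excess n)) / (1 - winProb j)) =
      √(1 - (winProb j + excess n)) :=
    mul_sqrt _ _ _ (by linarith) (mul_div_cancel₀ _ (by linarith))
  have e2 : (√(1 - winProb j) : ℂ) * √(excess n / (1 - winProb j)) = √(excess n) :=
    mul_sqrt _ _ _ (by linarith) (mul_div_cancel₀ _ (by linarith))
  have e3 : (√(winProb j + excess n) : ℂ) * √(excess n / (winProb j + excess n)) =
      √(excess n) :=
    mul_sqrt _ _ _ (by linarith) (mul_div_cancel₀ _ (by linarith))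
  have e4 : (√(winProb j + excess n) : ℂ) * √(winProb j / (winProb j + excess n)) =
      √(winProb j) :=
    mul_sqrt _ _ _ (by linarith) (mul_div_cancel₀ _ (by linarith))
  have r1 := run_sweep_respond (a := prepared j false) (a' := crown j.succ) (b := heard false)
    (m := lose) (m' := bit false) hσ (by simp [Equiv.swap_apply_def]) (by simp) (by simp) (by simp)
  have r2 := run_sweep_respond (a := prepared j true) (a' := crown j.succ) (b := kept)
    (m := lose) (m' := bit true) hσ (by simp [Equiv.swap_apply_def]) (by simp) (by simp) (by simp)
  have r3 := run_sweep_respond (a := prepared j true) (a' := Priv.out j) (b := won)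
    (m := win) (m' := blank) hσ (by simp [Equiv.swap_apply_def]) (by simp) (by simp) (by simp)
  rw [game, run_append, run_sweep_prepare hσ, run_append, run_add, run_smul, run_smul,
    run_claim_false, run_claim_true, run_append]
  simp only [run_add (sweep (respond j)), run_smul (sweep (respond j)), r1, r2, r3]
  rw [← run_verify_lose, ← run_verify_win, ← run_smul, ← run_smul, ← run_add]
  congr 1
  rw [smul_add, smul_smul, smul_smul, smul_add, smul_smul, smul_smul, e1, e2, e3, e4, add_assoc]

theorem IsConfig.stay (hσ : IsConfig j.castSucc l σ) :
    IsConfig j.succ l (setTwo σ l j.succ (crown j.succ) (Priv.out j)) where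
  king_le := hσ.king_le.trans j.castSucc_lt_succ.le
  king := setTwo_left _ _ hσ.king_ne
  out i hil hi := by
    by_cases hih : i = j.succ
    · subst hih
      exact ⟨j, j.castSucc_lt_succ, setTwo_right ..⟩
    · obtain ⟨c, hc, e⟩ := hσ.out i hil (Fin.le_castSucc_iff.2 (lt_of_le_of_ne hi hih))
      exact ⟨c, hc.trans j.castSucc_lt_succ, (setTwo_of_ne _ _ hil hih).trans e⟩
  wait i hi := by
    rw [setTwo_of_ne _ _ ((hσ.king_le.trans_lt j.castSucc_lt_succ).trans hi).ne' hi.ne']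
    exact hσ.wait i (j.castSucc_lt_succ.trans hi)

theorem IsConfig.pass (hσ : IsConfig j.castSucc l σ) :
    IsConfig j.succ j.succ (setTwo σ l j.succ (Priv.out j) (crown j.succ)) where
  king_le := le_rfl
  king := setTwo_right ..
  out i hih hi := by
    by_cases hil : i = l
    · subst hil
      exact ⟨j, j.castSucc_lt_succ, setTwo_left _ _ hσ.king_ne⟩
    · obtain ⟨c, hc, e⟩ := hσ.out i hil (Fin.le_castSucc_iff.2 (lt_of_le_of_ne hi hih))
      exact ⟨c, hc.trans j.castSucc_lt_succ, (setTwo_of_ne _ _ hil hih).trans e⟩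
  wait i hi := by
    rw [setTwo_of_ne _ _ ((hσ.king_le.trans_lt j.castSucc_lt_succ).trans hi).ne' hi.ne']
    exact hσ.wait i (j.castSucc_lt_succ.trans hi)

end game

/-- The superpositions of the configurations that occur after the games before game `m`. -/
def configSpan (m : Fin (n + 1)) : Submodule ℂ ((Fin (n + 1) → Priv n) × Msg × Unit → ℂ) :=
  Submodule.span ℂ {ψ | ∃ l σ, IsConfig m l σ ∧ ψ = ket σ blank}

theorem run_zero {k : ℕ} {A M : Type} [Fintype A] [DecidableEq A] [Fintype M] [DecidableEq M]
    (L : List (Round k A M)) : run L 0 = 0 := by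
  simpa using run_smul L 0 0

theorem run_game_mem (j : Fin n) {ψ : (Fin (n + 1) → Priv n) × Msg × Unit → ℂ}
    (hψ : ψ ∈ configSpan j.castSucc) : run (game j) ψ ∈ configSpan j.succ := by
  induction hψ using Submodule.span_induction with
  | mem ψ h =>
    obtain ⟨l, σ, hσ, rfl⟩ := h
    rw [run_game hσ]
    exact add_mem (Submodule.smul_mem _ _ (Submodule.subset_span ⟨_, _, hσ.stay, rfl⟩))
      (Submodule.smul_mem _ _ (Submodule.subset_span ⟨_, _, hσ.pass, rfl⟩))
  | zero => rw [run_zero]; exact zero_mem _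
  | add ψ χ _ _ h1 h2 => rw [run_add]; exact add_mem h1 h2
  | smul c ψ _ h => rw [run_smul]; exact Submodule.smul_mem _ _ h

theorem isConfig_initPriv (n : ℕ) : IsConfig 0 0 (initPriv n) where
  king_le := le_rfl
  king := if_pos rfl
  out _ hi h := absurd (Fin.le_zero_iff.1 h) hi
  wait _ hi := if_neg hi.ne'

theorem run_games_mem : ∀ (m : ℕ) (hm : m ≤ n),
    run (games m hm) (ket (initPriv n) blank) ∈ configSpan ⟨m, Nat.lt_succ_of_le hm⟩
  | 0, _ => Submodule.subset_span ⟨_, _, isConfig_initPriv n, rfl⟩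
  | m + 1, hm => by
    rw [games, run_append]
    exact run_game_mem ⟨m, hm⟩ (run_games_mem m (Nat.le_of_succ_le hm))

/-! ### The honest run of the final coin toss -/

/-- The exchange of the outcomes `0` and `1`, on a private register. -/
def Priv.flip : Priv n → Priv n
  | coin b => coin !b
  | copied j b => copied j !b
  | a => a

/-- The exchange of the bits `0` and `1`, on the message register. -/
def Msg.flip : Msg → Msg
  | bit b => bit !b
  | m => m

/-- The exchange of the outcomes `0` and `1`, on the joint space. -/
def flipBasis (x : (Fin (n + 1) → Priv n) × Msg × Unit) : (Fin (n + 1) → Priv n) × Msg × Unit :=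
  (fun i => (x.1 i).flip, x.2.1.flip, x.2.2)

theorem flipBasis_involutive : Function.Involutive (flipBasis (n := n)) := by
  rintro ⟨σ, m, u⟩
  refine Prod.ext (funext fun i => ?_) (Prod.ext ?_ rfl)
  · change (σ i).flip.flip = σ i
    cases σ i <;> simp [Priv.flip]
  · change m.flip.flip = m
    cases m <;> simp [Msg.flip]

theorem val_flip (a : Priv n) (b : Bool) : a.flip.val = some b ↔ a.val = some !b := by
  cases a <;> simp [Priv.flip, Priv.val]

/-- A state in which all parties hold the same outcome, and in which the two outcomes play the same
role. -/
structure IsFair (ψ : (Fin (n + 1) → Priv n) × Msg × Unit → ℂ) : Prop where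
  symm : ∀ x, ψ (flipBasis x) = ψ x
  agree : ∀ x, ψ x ≠ 0 → ∃ b, ∀ i, (x.1 i).val = some b

theorem ket_flipBasis (σ : Fin (n + 1) → Priv n) (m : Msg)
    (x : (Fin (n + 1) → Priv n) × Msg × Unit) :
    ket σ m (flipBasis x) = ket (fun i => (σ i).flip) m.flip x := by
  have : flipBasis x = (σ, m, ()) ↔ x = flipBasis (σ, m, ()) := by
    constructor
    · intro h
      rw [← h, flipBasis_involutive]
    · rintro rfl
      rw [flipBasis_involutive]
  change (Pi.single (σ, m, ()) 1 : _ → ℂ) _ = (Pi.single (flipBasis (σ, m, ())) 1 : _ → ℂ) x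
  simp only [Pi.single_apply, this]

theorem run_sweep_toss {l : Fin (n + 1)} {σ : Fin (n + 1) → Priv n}
    (hσ : IsConfig (Fin.last n) l σ) :
    run (sweep (toss n)) (ket σ blank) =
      (√(1 / 2 : ℝ) : ℂ) • (ket (Function.update σ l (coin false)) (bit false) +
        ket (Function.update σ l (coin true)) (bit true)) := by
  have idle : ∀ a m i, i ≠ l → run (toss n i) (ket (Function.update σ l a) m) =
      ket (Function.update σ l a) m := by
    intro a m i hil
    obtain ⟨c, -, e⟩ := hσ.out i hil (Fin.le_last i)
    rw [← Function.update_of_ne hil a σ] at e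
    rw [toss, run_cons, run_refl_ket_of_ne]
    · exact run_perm_ket_of_fixed _ _ (by simp [Equiv.swap_apply_def, e])
    all_goals simp [e]
  have idle' : ∀ m i, i ≠ l → run (toss n i) (ket σ m) = ket σ m := by
    intro m i hi
    simpa using idle (σ l) m i hi
  refine run_sweep_eq l ?_ (fun i hi => idle' _ i hi) fun i hi => ?_
  · rw [toss, run_cons, run_refl_ket_split _ _ _ _ _ _ hσ.king, run_add, run_smul,
      run_smul, run_perm_ket, run_perm_ket, ← smul_add]
    simp [Equiv.swap_apply_def]
  · rw [run_smul, run_add, idle _ _ i hi, idle _ _ i hi]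

theorem isFair_run_final {ψ : (Fin (n + 1) → Priv n) × Msg × Unit → ℂ}
    (hψ : ψ ∈ configSpan (Fin.last n)) :
    IsFair (run (sweep (toss n) ++ sweep fun i => [permRound i (copyPerm n)]) ψ) := by
  induction hψ using Submodule.span_induction with
  | mem ψ h =>
    obtain ⟨l, σ, hσ, rfl⟩ := h
    -- The configuration in which all parties hold the outcome `b`.
    set τ : Bool → Fin (n + 1) → Priv n := fun b i =>
      (copyFun n (Function.update σ l (coin b) i, bit b)).1 with hτ
    have hval : ∀ b i, (τ b i).val = some b ∧ (τ b i).flip = τ (!b) i := by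
      intro b i
      by_cases hil : i = l
      · subst hil
        simp [hτ, copyFun, Priv.val, Priv.flip]
      · obtain ⟨c, -, e⟩ := hσ.out i hil (Fin.le_last i)
        simp [hτ, hil, e, copyFun, Priv.val, Priv.flip]
    have hcopy : ∀ b, run (sweep fun i => [permRound i (copyPerm n)])
        (ket (Function.update σ l (coin b)) (bit b)) =
        ket (τ b) (bit b) := by
      intro b
      refine run_sweep_perm_ket _ _ _ fun a => ?_
      change (copyFun n (a, bit b)).2 = bit b
      cases a with
      | copied j c =>
        simp only [copyFun]
        split_ifs with h
        · rw [h]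
        · rfl
      | _ => rfl
    clear_value τ
    rw [run_append, run_sweep_toss hσ, run_smul, run_add, hcopy, hcopy]
    constructor
    · intro x
      simp only [Pi.smul_apply, Pi.add_apply, ket_flipBasis, hval, Msg.flip, Bool.not_false,
        Bool.not_true]
      rw [add_comm]
    · intro x hx
      have key : ∀ b, ket (τ b) (bit b) x ≠ 0 → ∃ b, ∀ i, (x.1 i).val = some b := by
        intro b hb
        refine ⟨b, fun i => ?_⟩
        have : x = (τ b, bit b, ()) := by
          by_contra h
          exact hb (Pi.single_eq_of_ne h _)
        rw [this]
        exact (hval b i).1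
      by_contra hn
      have hz : ∀ b, ket (τ b) (bit b) x = 0 := fun b => by
        by_contra h
        exact hn (key b h)
      exact hx (by simp [hz])
  | zero => rw [run_zero]; exact ⟨fun _ => rfl, fun x hx => absurd rfl hx⟩
  | add ψ χ _ _ h1 h2 =>
    rw [run_add]
    refine ⟨fun x => by simp [h1.symm x, h2.symm x], fun x hx => ?_⟩
    by_cases h : run (sweep (toss n) ++ sweep fun i => [permRound i (copyPerm n)]) ψ x = 0
    · exact h2.agree x fun h' => hx (by simp [h, h'])
    · exact h1.agree x h
  | smul c ψ _ h =>
    rw [run_smul]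
    exact ⟨fun x => by simp [h.symm x], fun x hx => h.agree x fun h' => hx (by simp [h'])⟩

theorem isFair_run_allRounds (n : ℕ) : IsFair (run (allRounds n) (ket (initPriv n) blank)) := by
  rw [allRounds, run_append]
  exact isFair_run_final (run_games_mem n le_rfl)

theorem sum_norm_sq_run_allRounds (n : ℕ) :
    ∑ x, ‖run (allRounds n) (ket (initPriv n) blank) x‖ ^ 2 = 1 := by
  have h := wnorm_one_run (allRounds n) (ket (initPriv n) blank)
  have h1 : ∑ x, ‖ket (initPriv n) blank x‖ ^ 2 = 1 := by
    rw [Finset.sum_eq_single (initPriv n, blank, ())]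
    · simp [ket]
    · intro x _ hx
      rw [ket, Pi.single_eq_of_ne hx]
      simp
    · simp
  rw [wnorm_one, wnorm_one, h1, ENNReal.ofReal_one, ENNReal.ofReal_eq_one] at h
  exact h

theorem IsFair.sum_outcome {ψ : (Fin (n + 1) → Priv n) × Msg × Unit → ℂ} (hψ : IsFair ψ)
    (h1 : ∑ x, ‖ψ x‖ ^ 2 = 1) (i : Fin (n + 1)) (b : Bool) :
    ∑ x, ‖if (x.1 i).val = some b then ψ x else 0‖ ^ 2 = 1 / 2 := by
  have hsymm : ∑ x, ‖if (x.1 i).val = some (!b) then ψ x else 0‖ ^ 2 =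
      ∑ x, ‖if (x.1 i).val = some b then ψ x else 0‖ ^ 2 := by
    rw [← Equiv.sum_comp flipBasis_involutive.toPerm]
    refine Finset.sum_congr rfl fun x _ => ?_
    change ‖if (x.1 i).flip.val = some (!b) then ψ (flipBasis x) else 0‖ ^ 2 = _
    simp only [val_flip, Bool.not_not, hψ.symm]
  have htot : ∑ x, ‖if (x.1 i).val = some b then ψ x else 0‖ ^ 2 +
      ∑ x, ‖if (x.1 i).val = some (!b) then ψ x else 0‖ ^ 2 = 1 := by
    rw [← h1, ← Finset.sum_add_distrib]
    refine Finset.sum_congr rfl fun x _ => ?_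
    by_cases hx : ψ x = 0
    · simp [hx]
    · obtain ⟨c, hc⟩ := hψ.agree x hx
      cases b <;> cases c <;> simp [hc]
  linarith

/-! ### The coin-flipping protocol -/

theorem isStrongCoinFlip_coinProtocol (n : ℕ) :
    (coinProtocol n).IsStrongCoinFlip (1 / 2 - 1 / 12 / ((n + 1 : ℕ) : ℝ)) where
  agree i i' b := by
    rw [coinProtocol, honestState_ofRounds]
    funext x
    refine (liftPrivate_ofRounds ..).trans (Eq.trans ?_ (liftPrivate_ofRounds ..).symm)
    change (if (x.1 i).val = some b then run (allRounds n) (ket (initPriv n) blank) x else 0) =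
      if (x.1 i').val = some b then run (allRounds n) (ket (initPriv n) blank) x else 0
    by_cases hx : run (allRounds n) (ket (initPriv n) blank) x = 0
    · simp [hx]
    · obtain ⟨c, hc⟩ := (isFair_run_allRounds n).agree x hx
      rw [hc, hc]
  fair i b := by
    rw [coinProtocol, honestState_ofRounds]
    refine Eq.trans (Finset.sum_congr rfl fun x _ => ?_)
      ((isFair_run_allRounds n).sum_outcome (sum_norm_sq_run_allRounds n) i b)
    exact congrArg (fun z : ℂ => ‖z‖ ^ 2) (liftPrivate_ofRounds ..)
  bias_le D S i b hi := by
    refine (coinProtocol_outcomeProb_le S hi b).trans_eq ?_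
    unfold waitBound
    push_cast
    field_simp
    ring

end honest

end QuantumCoin

/-- For some constant `c > 0` there is, for every number `k ≥ 1` of parties, a strong quantum
coin-flipping protocol with bias at most `1/2 - c/k`, even with `k - 1` dishonest parties. -/
theorem theorem4 :
    ∃ c : ℝ, 0 < c ∧ ∀ k : ℕ, 1 ≤ k →
      ∃ P : QuantumCoin.Protocol k, P.IsStrongCoinFlip (1 / 2 - c / (k : ℝ)) := by
  refine ⟨1 / 12, by norm_num, fun k hk => ?_⟩
  obtain ⟨n, rfl⟩ := Nat.exists_eq_add_of_le' hk
  exact ⟨QuantumCoin.coinProtocol n, QuantumCoin.isStrongCoinFlip_coinProtocol n⟩
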